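/- An input-driven pushdown automaton with translucent letters has finite sets of states $Q$ and pushdown symbols $\Gamma$, an initial state, a finite input alphabet $\Sigma$ partitioned into $\Sigma_D$ (push), $\Sigma_R$ (pop) and $\Sigma_N$ (pushdown unchanged), a map $\tau:Q\to 2^{\Sigma}$ (the letters that are translucent in a state), and partial transition functions which, for the current state, the letter from $\Sigma_D$, $\Sigma_R$, or $\Sigma_N\cup\{\vartriangleleft\}$ being processed and the topmost pushdown symbol (or the bottom symbol $\bot$, which is never removed), yield a set of possible successor states (together with the symbol to be pushed, for letters of $\Sigma_D$) or the verdict $\mathtt{accept}$. In state $q$ the automaton skips all letters of $\tau(q)$ to the right of its head, and processes and deletes the first letter not in $\tau(q)$; if there is none, it sees the endmarker $\vartriangleleft$, which is not deleted. In the returning mode the head goes back to the left end of the remaining input after every step; in the non-returning mode it continues from the position of the letter just processed and goes back to the left end only after a step on the endmarker. A word is accepted if some computation from the initial state, at the left end of the input and with empty pushdown, ends with $\mathtt{accept}$. The automaton is deterministic if there is always at most one choice (also on the endmarker). Let $\mathscr{L}(\mathsf{NIDPDAwtl})$ and $\mathscr{L}(\mathsf{DIDPDAwtl})$ be the families of languages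 accepted in the returning mode by nondeterministic and by deterministic such automata, and $\mathscr{L}(\mathsf{nrNIDPDAwtl})$, $\mathscr{L}(\mathsf{nrDIDPDAwtl})$ the corresponding families for the non-returning mode. Two languages over $\Sigma$ are letter-equivalent if they have the same Parikh image in $\mathbb{N}^{\Sigma}$, and a language is semilinear if its Parikh image is a semilinear set. Let $$L_{nsl}=\{\,a\,\$\#\,a^3\,\$\#^2\,a^5\,\$\#^3\cdots\$\#^{k-1}\,a^{2k-1}\,\$c^{k}\,a^{2k+1}\mid k\ge 0\,\}$$ over the four-letter alphabet $\{a,\$,\#,c\}$, where the word for $k=0$ is $a$ and the word for $k=1$ is $a\,\$c\,a^3$. Then: 1. $\mathscr{L}(\mathsf{DIDPDAwtl})\subset\mathscr{L}(\mathsf{nrDIDPDAwtl})$ and $\mathscr{L}(\mathsf{NIDPDAwtl})\subset\mathscr{L}(\mathsf{nrNIDPDAwtl})$, and both inclusions are proper. 2. Every language $L\in\mathscr{L}(\mathsf{NIDPDAwtl})$ has a context-free sublanguage $L'\subseteq L$ that is letter-equivalent to $L$, and $L$ is semilinear. 3. $L_{nsl}$ is not semilinear, and it separates the families: it belongs to $\mathscr{L}(\mathsf{nrDIDPDAwtl})$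 and to $\mathscr{L}(\mathsf{nrNIDPDAwtl})$, but neither to $\mathscr{L}(\mathsf{DIDPDAwtl})$ nor to $\mathscr{L}(\mathsf{NIDPDAwtl})$. -/

import Mathlib

namespace Translucent

/-- The effect of an input letter on the pushdown store. A map from the input alphabet to
`StackOp` is a signature, i.e. a partition of the alphabet into `Σ_D`, `Σ_R` and `Σ_N`. -/
inductive StackOp where
  /-- letters of `Σ_D` -/
  | push
  /-- letters of `Σ_R` -/
  | pop
  /-- letters of `Σ_N` -/
  | keep

/-- A value of a transition function, i.e. an element of `2^X ∪ {accept}`.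
That a (partial) transition function is undefined is expressed by the value `goto ∅`. -/
inductive Action (X : Type) where
  | goto (S : Set X)
  | accept

/-- The possible targets of a value of a transition function. -/
def Action.targets {X : Type} : Action X → Set X
  | .goto S => S
  | .accept => ∅

/-- There is at most one way to continue. -/
def Action.AtMostOne {X : Type} : Action X → Prop
  | .goto S => S.Subsingleton
  | .accept => True

/-- Input-driven pushdown automata with translucent input letters over the alphabet `α`.
The endmarker is `none : Option α`, and the bottom-of-pushdown symbol is `none : Option Γ`.
`deltaD`, `deltaR` and `deltaN` are only ever applied to letters of `Σ_D`, `Σ_R` and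
`Σ_N ∪ {endmarker}`; their values on other letters are never used. -/
structure Automaton (α : Type) where
  /-- internal states -/
  Q : Type
  /-- pushdown symbols -/
  Γ : Type
  finite_Q : Finite Q
  finite_Γ : Finite Γ
  /-- initial state -/
  start : Q
  /-- the partition of the input alphabet -/
  sig : α → StackOp
  /-- translucency mapping -/
  tau : Q → Set α
  deltaD : Q → α → Option Γ → Action (Q × Γ)
  deltaR : Q → α → Option Γ → Action Q
  deltaN : Q → Option α → Option Γ → Action Q

namespace Automaton

variable {α : Type}

/-- Determinism: at most one continuation for every state, every input letter or the endmarker,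
and every pushdown symbol or the bottom symbol. -/
structure Deterministic (M : Automaton α) : Prop where
  push : ∀ q a z, M.sig a = .push → (M.deltaD q a z).AtMostOne
  pop : ∀ q a z, M.sig a = .pop → (M.deltaR q a z).AtMostOne
  keep : ∀ q a z, M.sig a = .keep → (M.deltaN q (some a) z).AtMostOne
  endmarker : ∀ q z, (M.deltaN q none z).AtMostOne

/-- The transition function yields `accept` on the letter `a` in state `q` with topmost
pushdown symbol `z`. -/
def AcceptsOn (M : Automaton α) (q : M.Q) (a : α) (z : Option M.Γ) : Prop :=
  match M.sig a with
  | .push => M.deltaD q a z = .accept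
  | .pop => M.deltaR q a z = .accept
  | .keep => M.deltaN q (some a) z = .accept

/-- Processing the letter `a` in state `q` with pushdown content `γ` may lead to state `q'` and
pushdown content `γ'`. Pushdown contents are written without the bottom symbol, top first, so
that `γ.head?` is the topmost symbol (`none` is the bottom symbol), and popping from an
otherwise empty pushdown store leaves it unchanged. -/
def Moves (M : Automaton α) (q : M.Q) (a : α) (γ : List M.Γ) (q' : M.Q) (γ' : List M.Γ) : Prop :=
  match M.sig a with
  | .push => ∃ z', (q', z') ∈ (M.deltaD q a γ.head?).targets ∧ γ' = z' :: γ
  | .pop => q' ∈ (M.deltaR q a γ.head?).targets ∧ γ' = γ.tail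
  | .keep => q' ∈ (M.deltaN q (some a) γ.head?).targets ∧ γ' = γ

/-- Configurations in the returning mode: `run q w γ` has state `q`, remaining input `w` and
pushdown content `γ`. -/
inductive Config (M : Automaton α) where
  | run (q : M.Q) (w : List α) (γ : List M.Γ)
  | accept

/-- One step in the returning mode: the first letter that is not translucent is processed and
deleted, and the head returns to the left end. -/
inductive Step (M : Automaton α) : M.Config → M.Config → Prop where
  | letter {q q' : M.Q} {x y : List α} {a : α} {γ γ' : List M.Γ}
      (hx : ∀ b ∈ x, b ∈ M.tau q) (ha : a ∉ M.tau q) (h : M.Moves q a γ q' γ') :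
      Step M (.run q (x ++ a :: y) γ) (.run q' (x ++ y) γ')
  | letterAccept {q : M.Q} {x y : List α} {a : α} {γ : List M.Γ}
      (hx : ∀ b ∈ x, b ∈ M.tau q) (ha : a ∉ M.tau q) (h : M.AcceptsOn q a γ.head?) :
      Step M (.run q (x ++ a :: y) γ) .accept
  | endmarker {q q' : M.Q} {x : List α} {γ : List M.Γ}
      (hx : ∀ b ∈ x, b ∈ M.tau q) (h : q' ∈ (M.deltaN q none γ.head?).targets) :
      Step M (.run q x γ) (.run q' x γ)
  | endmarkerAccept {q : M.Q} {x : List α} {γ : List M.Γ}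
      (hx : ∀ b ∈ x, b ∈ M.tau q) (h : M.deltaN q none γ.head? = .accept) :
      Step M (.run q x γ) .accept

/-- The language accepted in the returning mode. -/
def language (M : Automaton α) : Language α :=
  {w | Relation.ReflTransGen M.Step (.run M.start w []) .accept}

/-- Configurations in the non-returning mode: `run u q w γ` has state `q`, remaining input `u`
to the left and `w` to the right of the head, and pushdown content `γ`. -/
inductive NRConfig (M : Automaton α) where
  | run (u : List α) (q : M.Q) (w : List α) (γ : List M.Γ)
  | accept

/-- One step in the non-returning mode: the first letter at or to the right of the head that is
not translucent is processed and deleted, and the head continues from there; it returns to the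
left end on the endmarker. -/
inductive NRStep (M : Automaton α) : M.NRConfig → M.NRConfig → Prop where
  | letter {q q' : M.Q} {u x y : List α} {a : α} {γ γ' : List M.Γ}
      (hx : ∀ b ∈ x, b ∈ M.tau q) (ha : a ∉ M.tau q) (h : M.Moves q a γ q' γ') :
      NRStep M (.run u q (x ++ a :: y) γ) (.run (u ++ x) q' y γ')
  | letterAccept {q : M.Q} {u x y : List α} {a : α} {γ : List M.Γ}
      (hx : ∀ b ∈ x, b ∈ M.tau q) (ha : a ∉ M.tau q) (h : M.AcceptsOn q a γ.head?) :
      NRStep M (.run u q (x ++ a :: y) γ) .accept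
  | endmarker {q q' : M.Q} {u x : List α} {γ : List M.Γ}
      (hx : ∀ b ∈ x, b ∈ M.tau q) (h : q' ∈ (M.deltaN q none γ.head?).targets) :
      NRStep M (.run u q x γ) (.run [] q' (u ++ x) γ)
  | endmarkerAccept {q : M.Q} {u x : List α} {γ : List M.Γ}
      (hx : ∀ b ∈ x, b ∈ M.tau q) (h : M.deltaN q none γ.head? = .accept) :
      NRStep M (.run u q x γ) .accept

/-- The language accepted in the non-returning mode. -/
def nrLanguage (M : Automaton α) : Language α :=
  {w | Relation.ReflTransGen M.NRStep (.run [] M.start w []) .accept}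

end Automaton

/-- A family of languages: for each finite alphabet the languages over it in the family. -/
abbrev LanguageFamily : Type 1 := (α : Type) → [Finite α] → Set (Language α)

/-- Proper inclusion of families of languages. -/
def ProperlyIncluded (F G : LanguageFamily) : Prop :=
  (∀ (α : Type) [Finite α], F α ⊆ G α) ∧
    ∃ (α : Type) (_ : Finite α) (L : Language α), L ∈ G α ∧ L ∉ F α

/-- Languages accepted by nondeterministic automata in the returning mode. -/
def NIDPDAwtl : LanguageFamily := fun α _ => {L | ∃ M : Automaton α, M.language = L}

/-- Languages accepted by deterministic automata in the returning mode. -/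
def DIDPDAwtl : LanguageFamily := fun α _ =>
  {L | ∃ M : Automaton α, M.Deterministic ∧ M.language = L}

/-- Languages accepted by nondeterministic automata in the non-returning mode. -/
def nrNIDPDAwtl : LanguageFamily := fun α _ => {L | ∃ M : Automaton α, M.nrLanguage = L}

/-- Languages accepted by deterministic automata in the non-returning mode. -/
def nrDIDPDAwtl : LanguageFamily := fun α _ =>
  {L | ∃ M : Automaton α, M.Deterministic ∧ M.nrLanguage = L}

open Classical in
/-- The Parikh vector of a word: the number of occurrences of each letter. -/
noncomputable def parikh {α : Type} (w : List α) : α → ℕ := fun a => w.count a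

/-- The Parikh image of a language. -/
def parikhImage {α : Type} (L : Language α) : Set (α → ℕ) := parikh '' (L : Set (List α))

/-- Two languages are letter-equivalent if they have the same Parikh image. -/
def LetterEquivalent {α : Type} (L₁ L₂ : Language α) : Prop := parikhImage L₁ = parikhImage L₂

/-- A language is semilinear if its Parikh image is a semilinear set. -/
def Semilinear {α : Type} (L : Language α) : Prop := IsSemilinearSet (parikhImage L)

/-- The four letters `a`, `$`, `#` and `¢`. -/
inductive Letter where
  | a
  | dollar
  | hash
  | cent

instance : Finite Letter :=
  Finite.of_surjective (fun i : Fin 4 => ![Letter.a, .dollar, .hash, .cent] i) fun x => by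
    cases x
    · exact ⟨0, rfl⟩
    · exact ⟨1, rfl⟩
    · exact ⟨2, rfl⟩
    · exact ⟨3, rfl⟩

/-- The word `a $ # a³ $ #² a⁵ $ #³ ⋯ a²ᵏ⁻¹ $ #ᵏ`. -/
def nslPrefix (k : ℕ) : List Letter :=
  (List.range k).flatMap fun i =>
    List.replicate (2 * i + 1) Letter.a ++ Letter.dollar :: List.replicate (i + 1) Letter.hash

/-- The `k`-th word of the language `nsl`: there are `k + 1` blocks of the letter `a`, of lengths
`1, 3, …, 2k + 1`, and the `k` separators `$#, $#², …, $#ᵏ⁻¹, $¢ᵏ` between them. For `k = 0`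
this is the word `a`. -/
def nslWord : ℕ → List Letter
  | 0 => [Letter.a]
  | k + 1 =>
    nslPrefix k ++ (List.replicate (2 * k + 1) Letter.a ++
      Letter.dollar :: (List.replicate (k + 1) Letter.cent ++
        List.replicate (2 * k + 3) Letter.a))

/-- The language `{ a $ # a³ $ #² a⁵ $ #³ ⋯ $ #ᵏ⁻¹ a²ᵏ⁻¹ $ ¢ᵏ a²ᵏ⁺¹ | k ≥ 0 }`. -/
def nsl : Language Letter := {w | ∃ k : ℕ, w = nslWord k}

end Translucent

/-! In the returning mode the letters of an accepted word can be rearranged into the order in which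
they are processed, any unread rest coming last. Each of them is then the very first letter when its
turn comes, and a step on the endmarker depends only on the set of letters that remain. So the
rearranged word is accepted by a computation that never skips before a letter step, as in an
ordinary pushdown automaton whose states also remember the set of letters still allowed. The triple
construction turns these computations into a context-free grammar (`grammar_language_le`,
`exists_perm_generated`), which gives the letter-equivalent sublanguage.

Semilinearity then follows from Parikh's theorem. It rests on a criterion of Euler type,
`realizes_iff`: a multiset of rules can be arranged into a derivation exactly when produced and
consumed nonterminals balance and every rule used is reachable. For a fixed set of rules used, this
is a linear equation.

The non-returning mode simulates the returning one by passing, after each letter, through a state in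
which everything is translucent (`returnSimulation`). It is strictly stronger because of `nsl`: the
numbers of letters `a` in its words are the squares, so it is not semilinear. A deterministic
non-returning automaton accepts it by sweeps: each one removes the first block and the first
separator and shortens all other blocks and separators by the same amounts, so that the word for `k`
is brought to the shape of the word for `k - 1`. A separator that vanishes too early merges its
neighbours. The pushdown excludes this: it forces as many sweeps as there were separators, and a
word that has lost a block too early cannot last that long (`blockWord_minimal`,
`acc_start_blockWord`). -/

namespace Translucent

/-! ### Parikh's theorem -/

section CommutativeRules

variable {N R : Type*} (lhs : R → N) (out : R → Multiset N)

/-- The multiset `m` of pending nonterminals can be rewritten to `0` by applying each rule exactly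
as often as it occurs in `n`. -/
inductive Realizes : Multiset N → Multiset R → Prop
  | nil : Realizes 0 0
  | cons (r : R) {m : Multiset N} {n : Multiset R} (h : Realizes (out r + m) n) :
      Realizes (lhs r ::ₘ m) (r ::ₘ n)

/-- The nonterminals that can be reached from those in `m` by the rules in `S`. -/
inductive Reach (m : Multiset N) (S : Set R) : N → Prop
  | base {A : N} (h : A ∈ m) : Reach m S A
  | step {r : R} {B : N} (hr : r ∈ S) (h : Reach m S (lhs r)) (hB : B ∈ out r) : Reach m S B

variable {lhs out}

theorem Reach.le_of_closed {m : Multiset N} {S : Set R} {P : N → Prop} (hm : ∀ A ∈ m, P A)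
    (hS : ∀ r ∈ S, P (lhs r) → ∀ B ∈ out r, P B) {A : N} (h : Reach lhs out m S A) : P A := by
  induction h with
  | base h => exact hm _ h
  | step hr _ hB ih => exact hS _ hr ih _ hB

/-- Every nonterminal that is pending at the start or produced later is consumed by exactly one rule
occurrence. -/
theorem Realizes.balance {m : Multiset N} {n : Multiset R} (h : Realizes lhs out m n) :
    m + n.bind out = n.map lhs := by
  induction h with
  | nil => simp
  | cons r h ih =>
    rw [Multiset.cons_bind, Multiset.map_cons, ← ih, Multiset.cons_add]
    congr 1
    abel

theorem Realizes.reach {m : Multiset N} {n : Multiset R} (h : Realizes lhs out m n) :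
    ∀ r ∈ n, Reach lhs out m {r | r ∈ n} (lhs r) := by
  induction h with
  | nil => simp
  | @cons r m n h ih =>
    have hr : Reach lhs out (lhs r ::ₘ m) {s | s ∈ r ::ₘ n} (lhs r) := .base (by simp)
    intro s hs
    rcases Multiset.mem_cons.1 hs with rfl | hs
    · exact hr
    refine (ih s hs).le_of_closed (fun A hA => ?_) fun t ht hl B hB => .step ?_ hl hB
    · rcases Multiset.mem_add.1 hA with hA | hA
      · exact .step (by simp) hr hA
      · exact .base (by simp [hA])
    · exact Multiset.mem_cons_of_mem ht

/-- A pending nonterminal admits a rule whose application keeps all remaining rules reachable. -/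
theorem exists_rule_reach {m : Multiset N} {n : Multiset R} {A : N}
    (hb : (A ::ₘ m) + n.bind out = n.map lhs)
    (hr : ∀ r ∈ n, Reach lhs out (A ::ₘ m) {r | r ∈ n} (lhs r)) :
    ∃ r n', n = r ::ₘ n' ∧ lhs r = A ∧
      ∀ s ∈ n', Reach lhs out (out r + m) {r | r ∈ n'} (lhs s) := by
  classical
  have hA : A ∈ n.map lhs := by rw [← hb]; simp
  obtain ⟨r₀, hr₀, hlr₀⟩ := Multiset.mem_map.1 hA
  -- Either applying some rule keeps `A` reachable, or `A` has only one rule left.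
  by_cases hex : ∃ r ∈ n, lhs r = A ∧ Reach lhs out (out r + m) {s | s ∈ n.erase r} A
  · obtain ⟨r, hrn, hl, hreach⟩ := hex
    refine ⟨r, n.erase r, (Multiset.cons_erase hrn).symm, hl, fun s hs => ?_⟩
    refine (hr s (Multiset.mem_of_mem_erase hs)).le_of_closed (fun B hB => ?_) ?_
    · rcases Multiset.mem_cons.1 hB with rfl | hB
      · exact hreach
      · exact .base (by simp [hB])
    · intro t ht hlt B hB
      by_cases htr : t = r
      · subst htr
        exact .base (by simp [hB])
      · exact .step ((Multiset.mem_erase_of_ne htr).2 ht) hlt hB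
  · push Not at hex
    refine ⟨r₀, n.erase r₀, (Multiset.cons_erase hr₀).symm, hlr₀, fun s hs => ?_⟩
    have hs' := Multiset.mem_of_mem_erase hs
    -- In a chain leading to `B`, take the last rule `r` for `A`; the rest of the chain does not use
    -- `r` again, so it survives the removal of `r`.
    have hclosed : ∀ B, Reach lhs out (A ::ₘ m) {r | r ∈ n} B →
        B = A ∨ ∃ r ∈ n, lhs r = A ∧ Reach lhs out (out r + m) {s | s ∈ n.erase r} B := by
      intro B hB
      refine hB.le_of_closed (P := fun B => B = A ∨ ∃ r ∈ n, lhs r = A ∧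
        Reach lhs out (out r + m) {s | s ∈ n.erase r} B) (fun C hC => ?_) ?_
      · rcases Multiset.mem_cons.1 hC with rfl | hC
        · exact .inl rfl
        · exact .inr ⟨r₀, hr₀, hlr₀, .base (by simp [hC])⟩
      · rintro t ht (hl | ⟨r, hrn, hl, hre⟩) C hC
        · exact .inr ⟨t, ht, hl, .base (by simp [hC])⟩
        · by_cases htA : lhs t = A
          · exact .inr ⟨t, ht, htA, .base (by simp [hC])⟩
          · exact .inr ⟨r, hrn, hl, .step ((Multiset.mem_erase_of_ne
              (by rintro rfl; exact htA hl)).2 ht) hre hC⟩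
    -- If `A` were pending a second time or produced by some rule, it would stay reachable after a
    -- suitable rule for `A` is applied.
    have hnot : A ∉ m + n.bind out := by
      intro hmem
      rcases Multiset.mem_add.1 hmem with hm | hm
      · exact hex r₀ hr₀ hlr₀ (.base (by simp [hm]))
      · obtain ⟨t, ht, hAt⟩ := Multiset.mem_bind.1 hm
        by_cases htA : lhs t = A
        · exact hex t ht htA (.base (by simp [hAt]))
        · rcases hclosed _ (hr t ht) with h | ⟨r, hrn, hl, hre⟩
          · exact htA h
          · exact hex r hrn hl (.step ((Multiset.mem_erase_of_ne
              (by rintro rfl; exact htA hl)).2 ht) hre hAt)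
    -- By balance, a second rule for `A` would need another occurrence of `A`.
    have hlast : ∀ t ∈ n.erase r₀, lhs t ≠ A := by
      intro t ht hlt
      apply hnot
      have h1 : m + n.bind out = (n.erase r₀).map lhs := by
        rw [← Multiset.cons_erase hr₀, Multiset.map_cons, hlr₀, Multiset.cons_add,
          Multiset.cons_inj_right] at hb
        rw [← hb, Multiset.cons_erase hr₀]
      rw [h1]
      exact Multiset.mem_map.2 ⟨t, ht, hlt⟩
    suffices h : lhs s = A ∨ Reach lhs out (out r₀ + m) {r | r ∈ n.erase r₀} (lhs s) from
      h.resolve_left (hlast s hs)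
    refine (hr s hs').le_of_closed (P := fun B => B = A ∨ Reach lhs out (out r₀ + m) _ B)
      (fun B hB => ?_) ?_
    · rcases Multiset.mem_cons.1 hB with rfl | hB
      · exact .inl rfl
      · exact .inr (.base (by simp [hB]))
    · intro t ht hlt B hB
      by_cases htr : t = r₀
      · subst htr
        exact .inr (.base (by simp [hB]))
      · have ht' := (Multiset.mem_erase_of_ne htr).2 ht
        exact .inr (.step ht' (hlt.resolve_left (hlast t ht')) hB)

/-- The analogue of Euler's criterion for trails: balance and connectedness suffice, because
`exists_rule_reach` always finds a rule that destroys neither. -/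
theorem realizes_iff {m : Multiset N} {n : Multiset R} :
    Realizes lhs out m n ↔ m + n.bind out = n.map lhs ∧
      ∀ r ∈ n, Reach lhs out m {r | r ∈ n} (lhs r) := by
  refine ⟨fun h => ⟨h.balance, h.reach⟩, ?_⟩
  rintro ⟨hb, hr⟩
  induction hc : n.card generalizing m n with
  | zero =>
    obtain rfl := Multiset.card_eq_zero.1 hc
    obtain rfl : m = 0 := by simpa using hb
    exact .nil
  | succ k ih =>
    induction m using Multiset.induction with
    | empty =>
      exfalso
      obtain ⟨r, hrn⟩ := Multiset.card_pos_iff_exists_mem.1 (by omega : 0 < n.card)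
      exact (hr r hrn).le_of_closed (P := fun _ => False) (by simp) (by simp)
    | cons A m _ =>
      obtain ⟨r, n', rfl, rfl, hr'⟩ := exists_rule_reach hb hr
      refine .cons r (ih ?_ hr' (by simpa using hc))
      rw [Multiset.cons_bind, Multiset.map_cons, Multiset.cons_add, Multiset.cons_inj_right] at hb
      rw [← hb]
      abel

/-- Needed for the set of all multisets of rules to be semilinear. -/
instance [Finite R] : AddMonoid.FG (Multiset R) :=
  AddMonoid.fg_iff.2 ⟨Set.range fun r => {r}, by
    refine top_unique fun n _ => ?_
    induction n using Multiset.induction with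
    | empty => exact zero_mem _
    | cons r n ih =>
      rw [← Multiset.singleton_add]
      exact add_mem (AddSubmonoid.subset_closure ⟨r, rfl⟩) (ih trivial), Set.finite_range _⟩

variable (lhs out) in
theorem isSemilinearSet_realizes [Finite R] (m : Multiset N) :
    IsSemilinearSet {n | Realizes lhs out m n} := by
  have hmem : ∀ r : R, IsSemilinearSet {n : Multiset R | r ∈ n} := by
    intro r
    have h := (IsSemilinearSet.univ (M := Multiset R)).vadd {r}
    convert! h using 1
    ext n
    rw [Set.mem_vadd_set]
    constructor
    · intro h
      obtain ⟨t, rfl⟩ := Multiset.exists_cons_of_mem h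
      exact ⟨t, trivial, by simp⟩
    · rintro ⟨t, -, rfl⟩
      simp
  have hsupp : ∀ S : Set R, IsSemilinearSet {n : Multiset R | {r | r ∈ n} = S} := by
    intro S
    have h : IsSemilinearSet (⋂ r : R, {n : Multiset R | r ∈ n ↔ r ∈ S}) := by
      refine .iInter fun r => ?_
      by_cases hr : r ∈ S
      · simpa [hr] using hmem r
      · simp only [hr, iff_false]
        exact (hmem r).compl
    convert! h using 1
    ext n
    simp [Set.ext_iff]
  let fout : Multiset R →+ Multiset N :=
    { toFun n := n.bind out, map_zero' := by simp, map_add' := by simp }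
  have hbal : IsSemilinearSet {n : Multiset R | m + n.bind out = n.map lhs} := by
    have h := isSemilinearSet_setOfPred_eq m 0 fout (Multiset.mapAddMonoidHom lhs)
    simp only [zero_add] at h
    exact h
  -- Reachability depends only on the set `S` of rules that occur. There are finitely many such
  -- sets, and for each of them only the linear balance equation remains.
  have h : IsSemilinearSet (⋃ S : {S : Set R // ∀ r ∈ S, Reach lhs out m S (lhs r)},
      {n : Multiset R | m + n.bind out = n.map lhs} ∩ {n : Multiset R | {r | r ∈ n} = S.1}) :=
    .iUnion fun S => hbal.inter (hsupp S.1)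
  convert! h using 1
  ext n
  simp only [realizes_iff, Set.mem_iUnion, Set.mem_inter_iff]
  exact ⟨fun ⟨h1, h2⟩ => ⟨⟨_, h2⟩, h1, rfl⟩, fun ⟨⟨S, hS⟩, h1, h2⟩ => ⟨h1, by subst h2; exact hS⟩⟩

end CommutativeRules

/-! ### Context-free derivations as commutative derivations -/

section Grammar

variable {T N : Type*}

/-- The multiset of nonterminals of a sentential form. -/
def nonterminals (u : List (Symbol T N)) : Multiset N :=
  (u.filterMap fun | .nonterminal A => some A | .terminal _ => none : List N)

/-- The multiset of terminals of a sentential form. -/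
def terminals (u : List (Symbol T N)) : Multiset T :=
  (u.filterMap fun | .terminal a => some a | .nonterminal _ => none : List T)

@[simp] theorem nonterminals_append (u v : List (Symbol T N)) :
    nonterminals (u ++ v) = nonterminals u + nonterminals v := by
  simp [nonterminals]

@[simp] theorem terminals_append (u v : List (Symbol T N)) :
    terminals (u ++ v) = terminals u + terminals v := by
  simp [terminals]

@[simp] theorem nonterminals_cons (A : N) (v : List (Symbol T N)) :
    nonterminals (.nonterminal A :: v) = A ::ₘ nonterminals v := by
  simp [nonterminals]

@[simp] theorem terminals_nonterminal_cons (A : N) (v : List (Symbol T N)) :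
    terminals (.nonterminal A :: v) = terminals v := by
  simp [terminals]

@[simp] theorem nonterminals_map_terminal (w : List T) :
    nonterminals (w.map (Symbol.terminal (N := N))) = 0 := by
  simp [nonterminals, List.filterMap_map]

@[simp] theorem terminals_map_terminal (w : List T) :
    terminals (w.map (Symbol.terminal (N := N))) = w := by
  simp [terminals, List.filterMap_map]

theorem exists_eq_map_terminal {u : List (Symbol T N)} (h : nonterminals u = 0) :
    ∃ w : List T, u = w.map .terminal := by
  induction u with
  | nil => exact ⟨[], rfl⟩
  | cons x u ih =>
    cases x with
    | nonterminal A => simp at h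
    | terminal a =>
      obtain ⟨w, rfl⟩ := ih (by simpa [nonterminals] using h)
      exact ⟨a :: w, rfl⟩

theorem mem_of_mem_nonterminals {A : N} {u : List (Symbol T N)} (h : A ∈ nonterminals u) :
    .nonterminal A ∈ u := by
  simp only [nonterminals, Multiset.mem_coe, List.mem_filterMap] at h
  obtain ⟨x, hx, hA⟩ := h
  cases x with
  | nonterminal B => simpa [← Option.some.inj hA] using hx
  | terminal a => simp at hA

variable (g : ContextFreeGrammar T)

/-- The position at which a nonterminal is rewritten does not affect the letter counts, so any
occurrence of it may be chosen. -/
theorem Realizes.exists_derives {m : Multiset g.NT} {n : Multiset g.rules}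
    (h : Realizes (fun r : g.rules => r.1.input) (fun r => nonterminals r.1.output) m n) :
    ∀ u : List (Symbol T g.NT), nonterminals u = m → ∃ w : List T,
      g.Derives u (w.map .terminal) ∧ (w : Multiset T) =
        terminals u + n.bind fun r => terminals r.1.output := by
  induction h with
  | nil =>
    intro u hu
    obtain ⟨w, rfl⟩ := exists_eq_map_terminal hu
    exact ⟨w, Relation.ReflTransGen.refl, by simp⟩
  | @cons r m n _ ih =>
    intro u hu
    obtain ⟨p, q, rfl⟩ := List.append_of_mem
      (mem_of_mem_nonterminals (A := r.1.input) (u := u) (by simp [hu]))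
    have hm : nonterminals p + nonterminals q = m := by
      simpa using hu
    obtain ⟨w, hw, hw'⟩ := ih (p ++ r.1.output ++ q) (by simp [← hm]; abel)
    refine ⟨w, .head ⟨r.1, r.2, ?_⟩ hw, ?_⟩
    · simpa using r.1.rewrites_of_exists_parts p q
    · rw [hw']
      simp only [terminals_append, Multiset.cons_bind, terminals_nonterminal_cons]
      abel

theorem exists_realizes {u : List (Symbol T g.NT)} {w : List T}
    (h : g.Derives u (w.map .terminal)) : ∃ n : Multiset g.rules,
      Realizes (fun r : g.rules => r.1.input) (fun r => nonterminals r.1.output)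
        (nonterminals u) n ∧
      (w : Multiset T) = terminals u + n.bind fun r => terminals r.1.output := by
  induction h using Relation.ReflTransGen.head_induction_on with
  | refl => exact ⟨0, by simpa using .nil, by simp⟩
  | head h _ ih =>
    obtain ⟨r, hr, hrw⟩ := h
    obtain ⟨p, q, rfl, rfl⟩ := hrw.exists_parts
    obtain ⟨n, hn, hw⟩ := ih
    refine ⟨⟨r, hr⟩ ::ₘ n, ?_, ?_⟩
    · convert! Realizes.cons (lhs := fun r : g.rules => r.1.input)
        (out := fun r => nonterminals r.1.output) ⟨r, hr⟩
        (m := nonterminals p + nonterminals q) (n := n) ?_ using 1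
      · simp
      · convert! hn using 1
        simp only [nonterminals_append]
        abel
    · rw [hw]
      simp only [terminals_append, Multiset.cons_bind, terminals_nonterminal_cons,
        List.append_assoc, List.singleton_append]
      abel

end Grammar

/-- Parikh's theorem. -/
theorem semilinear_of_isContextFree {α : Type} {L : Language α} (h : L.IsContextFree) :
    Semilinear L := by
  classical
  obtain ⟨g, rfl⟩ := h
  -- The Parikh vector of a derived word is additive in the rules used, so the Parikh image is the
  -- image of a semilinear set under `f`.
  let f : Multiset g.rules →+ (α → ℕ) :=
    { toFun n a := (n.bind fun r => terminals r.1.output).count a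
      map_zero' := by ext; simp
      map_add' := by intros; ext; simp }
  have := (isSemilinearSet_realizes (fun r : g.rules => r.1.input)
    (fun r => nonterminals r.1.output) {g.initial}).image f
  unfold Semilinear
  convert! this using 1
  ext v
  constructor
  · rintro ⟨w, hw, rfl⟩
    obtain ⟨n, hn, hw'⟩ := exists_realizes g hw
    refine ⟨n, by simpa [nonterminals] using hn, ?_⟩
    ext a
    simp only [parikh, ← Multiset.coe_count, hw']
    simp [f, terminals]
  · rintro ⟨n, hn, rfl⟩
    obtain ⟨w, hw, hw'⟩ := hn.exists_derives g [.nonterminal g.initial] (by simp [nonterminals])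
    refine ⟨w, hw, ?_⟩
    ext a
    simp only [parikh, ← Multiset.coe_count, hw']
    simp [f, terminals]

/-! ### Interpretations of nonterminals -/

section Yields

variable {T N : Type*}

/-- `Yields I u w` holds if `w` can be obtained from the sentential form `u` by replacing each
nonterminal `A` by a word of `I A`. -/
inductive Yields (I : N → Set (List T)) : List (Symbol T N) → List T → Prop
  | nil : Yields I [] []
  | terminal (a : T) {u : List (Symbol T N)} {w : List T} (h : Yields I u w) :
      Yields I (.terminal a :: u) (a :: w)
  | nonterminal {A : N} {u : List (Symbol T N)} {v w : List T} (hA : v ∈ I A) (h : Yields I u w) :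
      Yields I (.nonterminal A :: u) (v ++ w)

variable {I : N → Set (List T)}

theorem Yields.append {u v : List (Symbol T N)} {x y : List T} (hu : Yields I u x)
    (hv : Yields I v y) : Yields I (u ++ v) (x ++ y) := by
  induction hu with
  | nil => exact hv
  | terminal a _ ih => exact .terminal a ih
  | nonterminal hA _ ih => simpa using .nonterminal hA ih

theorem Yields.exists_of_append {u v : List (Symbol T N)} {w : List T} (h : Yields I (u ++ v) w) :
    ∃ x y, w = x ++ y ∧ Yields I u x ∧ Yields I v y := by
  induction u generalizing w with
  | nil => exact ⟨[], w, rfl, .nil, h⟩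
  | cons s u ih =>
    cases h with
    | terminal a h =>
      obtain ⟨x, y, rfl, hx, hy⟩ := ih h
      exact ⟨a :: x, y, rfl, .terminal a hx, hy⟩
    | @nonterminal _ _ v' _ hA h =>
      obtain ⟨x, y, rfl, hx, hy⟩ := ih h
      exact ⟨v' ++ x, y, by simp, .nonterminal hA hx, hy⟩

theorem Yields.map_terminal (w : List T) : Yields I (w.map .terminal) w := by
  induction w with
  | nil => exact .nil
  | cons a w ih => exact .terminal a ih

theorem Yields.single {A : N} {w : List T} (hA : w ∈ I A) : Yields I [.nonterminal A] w := by
  simpa using Yields.nonterminal hA .nil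

theorem yields_singleton {A : N} {w : List T} : Yields I [.nonterminal A] w ↔ w ∈ I A := by
  refine ⟨fun h => ?_, .single⟩
  rcases h with _ | _ | @⟨_, _, v, _, hA, ⟨⟩⟩
  simpa using hA

/-- An interpretation of the nonterminals that is closed under the rules of a grammar is closed
under derivations. -/
theorem Yields.of_derives {g : ContextFreeGrammar T} {I : g.NT → Set (List T)}
    (hI : ∀ r ∈ g.rules, ∀ w, Yields I r.output w → w ∈ I r.input)
    {u v : List (Symbol T g.NT)} (h : g.Derives u v) {w : List T} (hw : Yields I v w) :
    Yields I u w := by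
  induction h with
  | refl => exact hw
  | tail _ h ih =>
    apply ih
    obtain ⟨r, hr, hrw⟩ := h
    obtain ⟨p, q, rfl, rfl⟩ := hrw.exists_parts
    obtain ⟨x, y, rfl, hx, hy⟩ := hw.exists_of_append
    obtain ⟨x, z, rfl, hx, hz⟩ := hx.exists_of_append
    exact (hx.append (.single (hI r hr _ hz))).append hy

/-- The words derivable from a nonterminal. -/
def derivable (g : ContextFreeGrammar T) (A : g.NT) : Set (List T) :=
  {w | g.Derives [.nonterminal A] (w.map .terminal)}

theorem Yields.derives {g : ContextFreeGrammar T} {u : List (Symbol T g.NT)} {w : List T}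
    (h : Yields (derivable g) u w) : g.Derives u (w.map .terminal) := by
  induction h with
  | nil => exact Relation.ReflTransGen.refl
  | terminal a _ ih => exact ih.append_left [.terminal a]
  | @nonterminal A u v w hA _ ih =>
    rw [List.map_append]
    exact (ContextFreeGrammar.Derives.append_right (v := [.nonterminal A]) hA u).trans
      (ih.append_left _)

theorem mem_derivable_of_yields {g : ContextFreeGrammar T} {r : ContextFreeRule T g.NT}
    (hr : r ∈ g.rules) {w : List T} (h : Yields (derivable g) r.output w) :
    w ∈ derivable g r.input :=
  h.derives.head ⟨r, hr, ContextFreeRule.Rewrites.input_output⟩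

end Yields

namespace Automaton

variable {α : Type} (M : Automaton α)

/-! ### The context-free sublanguage of words processed from left to right -/

/-- Nonterminals of the grammar for the words that are processed from left to right. States are
paired with the set of letters that may still occur in the remaining input. The nonterminal
`Sum.inl (s, z, some t)` generates the inputs that lead from `s` to `t` without touching the
pushdown content, which has topmost symbol `z`; with `none` in place of `some t` it generates the
inputs that lead to acceptance. The nonterminal `Sum.inr T` generates all words over `T`. -/
abbrev Nonterm : Type :=
  ((M.Q × Set α) × Option M.Γ × Option (M.Q × Set α)) ⊕ Set α

/-- The rules of the grammar for the words that are processed from left to right. -/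
inductive IsRule : M.Nonterm → List (Symbol α M.Nonterm) → Prop
  | done (s : M.Q × Set α) (z : Option M.Γ) : IsRule (.inl (s, z, some s)) []
  | stay {q q' : M.Q} {T : Set α} {z : Option M.Γ} {a : α} (o : Option (M.Q × Set α))
      (ha : a ∈ T) (ha' : a ∉ M.tau q) (h : ∀ γ, γ.head? = z → M.Moves q a γ q' γ) :
      IsRule (.inl ((q, T), z, o)) [.terminal a, .nonterminal (.inl ((q', T), z, o))]
  | endmarker {q q' : M.Q} {T : Set α} {z : Option M.Γ} (o : Option (M.Q × Set α))
      (h : q' ∈ (M.deltaN q none z).targets) :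
      IsRule (.inl ((q, T), z, o)) [.nonterminal (.inl ((q', T ∩ M.tau q), z, o))]
  | pushPop {q q' p p' : M.Q} {T T' : Set α} {z : Option M.Γ} {z' : M.Γ} {a b : α}
      (o : Option (M.Q × Set α)) (ha : a ∈ T) (ha' : a ∉ M.tau q)
      (h : ∀ γ, γ.head? = z → M.Moves q a γ q' (z' :: γ)) (hb : b ∈ T') (hb' : b ∉ M.tau p)
      (h' : ∀ γ, M.Moves p b (z' :: γ) p' γ) :
      IsRule (.inl ((q, T), z, o))
        [.terminal a, .nonterminal (.inl ((q', T), some z', some (p, T'))),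
          .terminal b, .nonterminal (.inl ((p', T'), z, o))]
  | pushOpen {q q' : M.Q} {T : Set α} {z : Option M.Γ} {z' : M.Γ} {a : α}
      (ha : a ∈ T) (ha' : a ∉ M.tau q) (h : ∀ γ, γ.head? = z → M.Moves q a γ q' (z' :: γ)) :
      IsRule (.inl ((q, T), z, none)) [.terminal a, .nonterminal (.inl ((q', T), some z', none))]
  | letterAccept {q : M.Q} {T : Set α} {z : Option M.Γ} {a : α} (ha : a ∈ T) (ha' : a ∉ M.tau q)
      (h : M.AcceptsOn q a z) :
      IsRule (.inl ((q, T), z, none)) [.terminal a, .nonterminal (.inr T)]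
  | endmarkerAccept {q : M.Q} {T : Set α} {z : Option M.Γ} (h : M.deltaN q none z = .accept) :
      IsRule (.inl ((q, T), z, none)) [.nonterminal (.inr (T ∩ M.tau q))]
  | restNil (T : Set α) : IsRule (.inr T) []
  | restCons {T : Set α} {b : α} (hb : b ∈ T) :
      IsRule (.inr T) [.terminal b, .nonterminal (.inr T)]

theorem IsRule.length_le {A : M.Nonterm} {u : List (Symbol α M.Nonterm)} (h : M.IsRule A u) :
    u.length ≤ 4 := by
  cases h <;> simp

/-- Right-hand sides have bounded length over a finite set of symbols. -/
theorem finite_rules [Finite α] :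
    {r : ContextFreeRule α M.Nonterm | M.IsRule r.input r.output}.Finite := by
  have := M.finite_Q
  have := M.finite_Γ
  have : Finite (Symbol α M.Nonterm) := Finite.of_surjective
    (Sum.elim Symbol.terminal Symbol.nonterminal : α ⊕ M.Nonterm → _) fun s => by
      cases s with
      | terminal a => exact ⟨.inl a, rfl⟩
      | nonterminal A => exact ⟨.inr A, rfl⟩
  refine .of_finite_image (f := fun r => (r.input, r.output))
    (((Set.finite_univ (α := M.Nonterm)).prod (List.finite_length_le (Symbol α M.Nonterm) 4)).subset
      ?_) ?_
  · rintro _ ⟨r, hr, rfl⟩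
    exact ⟨trivial, hr.length_le⟩
  · rintro ⟨A, u⟩ _ ⟨B, v⟩ _ h
    simpa using h

/-- The grammar for the words that are processed from left to right. -/
noncomputable def grammar [Finite α] : ContextFreeGrammar α where
  NT := M.Nonterm
  initial := .inl ((M.start, Set.univ), none, none)
  rules := M.finite_rules.toFinset

/-- `M.Target o γ y c` holds if `c` is the configuration that a computation described by a
nonterminal with target `o` reaches on remaining input `y` and pushdown content `γ`. -/
inductive Target : Option (M.Q × Set α) → List M.Γ → List α → M.Config → Prop
  | run {p : M.Q} {T : Set α} {y : List α} (γ : List M.Γ) (hy : ∀ b ∈ y, b ∈ T) :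
      Target (some (p, T)) γ y (.run p y γ)
  | accept (γ : List M.Γ) : Target none γ [] .accept

/-- The intended interpretation of the nonterminals. -/
def interpretation : M.Nonterm → Set (List α)
  | .inl ((q, T), z, o) => {w | ∀ γ y c, γ.head? = z → M.Target o γ y c →
      (∀ b ∈ w ++ y, b ∈ T) ∧ Relation.ReflTransGen M.Step (.run q (w ++ y) γ) c}
  | .inr T => {w | ∀ b ∈ w, b ∈ T}

variable {M}

theorem Step.first {q q' : M.Q} {a : α} {y : List α} {γ γ' : List M.Γ} (ha : a ∉ M.tau q)
    (h : M.Moves q a γ q' γ') : M.Step (.run q (a :: y) γ) (.run q' y γ') :=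
  .letter (x := []) (by simp) ha h

/-- The interpretation asserts two things together: that a computation exists and that all remaining
letters lie in `T`. The second licenses the endmarker steps: such a step in `q` replaces `T` by `T ∩
M.tau q`, so everything generated afterwards is translucent in `q`. -/
theorem IsRule.sound {A : M.Nonterm} {u : List (Symbol α M.Nonterm)} (h : M.IsRule A u)
    {w : List α} (hw : Yields M.interpretation u w) : w ∈ M.interpretation A := by
  cases h with
  | done s z =>
    cases hw
    rintro γ y c hγ ⟨⟩
    exact ⟨by simpa, .refl⟩
  | stay o ha ha' h =>
    rcases hw with _ | ⟨_, hw⟩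
    rw [yields_singleton] at hw
    intro γ y c hγ hc
    obtain ⟨h1, h2⟩ := hw γ y c hγ hc
    exact ⟨by simpa [ha] using h1, h2.head (.first ha' (h γ hγ))⟩
  | @endmarker q q' T _ o h =>
    rw [yields_singleton] at hw
    intro γ y c hγ hc
    obtain ⟨h1, h2⟩ := hw γ y c hγ hc
    exact ⟨fun b hb => (h1 b hb).1,
      h2.head (.endmarker (fun b hb => (h1 b hb).2) (by rwa [hγ]))⟩
  | @pushPop q q' p p' T T' z z' a b o ha ha' h hb hb' h' =>
    rcases hw with _ | ⟨_, hw⟩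
    rcases hw with _ | _ | @⟨_, _, v, _, hv, hw⟩
    rcases hw with _ | @⟨_, _, w, hw⟩
    rw [yields_singleton] at hw
    intro γ y c hγ hc
    obtain ⟨h1, h2⟩ := hw γ y c hγ hc
    obtain ⟨h3, h4⟩ := hv (z' :: γ) (b :: (w ++ y)) _ rfl (.run _ (by simpa [hb] using h1))
    refine ⟨by simpa [ha] using h3, .head (.first (γ' := z' :: γ) ha' (h γ hγ)) ?_⟩
    simpa using h4.trans (h2.head (.first hb' (h' γ)))
  | @pushOpen q q' T z z' a ha ha' h =>
    rcases hw with _ | ⟨_, hw⟩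
    rw [yields_singleton] at hw
    rintro γ y c hγ ⟨⟩
    obtain ⟨h1, h2⟩ := hw (z' :: γ) [] _ rfl (.accept _)
    exact ⟨by simpa [ha] using h1, h2.head (.first ha' (h γ hγ))⟩
  | letterAccept ha ha' h =>
    rcases hw with _ | @⟨_, _, w, hw⟩
    rw [yields_singleton] at hw
    rintro γ y c hγ ⟨⟩
    have hw : ∀ b ∈ w, b ∈ _ := hw
    refine ⟨by simpa [ha] using hw, .single ?_⟩
    exact .letterAccept (x := []) (by simp) ha' (by rwa [hγ])
  | endmarkerAccept h =>
    rw [yields_singleton] at hw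
    rintro γ y c hγ ⟨⟩
    rw [List.append_nil]
    exact ⟨fun b hb => (hw b hb).1, .single (.endmarkerAccept (fun b hb => (hw b hb).2)
      (by rwa [hγ]))⟩
  | restNil T =>
    cases hw
    simp [interpretation]
  | restCons hb =>
    rcases hw with _ | ⟨_, hw⟩
    rw [yields_singleton] at hw
    simpa [interpretation, hb] using hw

variable (M) in
theorem grammar_language_le [Finite α] : M.grammar.language ≤ M.language := by
  intro w hw
  have h := Yields.of_derives (I := M.interpretation)
    (fun r hr w hw => IsRule.sound (M.finite_rules.mem_toFinset.1 hr) hw) hw (.map_terminal w)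
  have h := (yields_singleton.1 h) [] [] _ rfl (.accept _)
  rw [List.append_nil] at h
  exact h.2

/-- The three cases match the shapes of the grammar rules, each stated uniformly in the part of the
pushdown that is not inspected. Popping from the empty pushdown falls under the first case. -/
theorem Moves.cases {q q' : M.Q} {a : α} {γ γ' : List M.Γ} (h : M.Moves q a γ q' γ') :
    (γ' = γ ∧ ∀ δ : List M.Γ, δ.head? = γ.head? → M.Moves q a δ q' δ) ∨
    (∃ z, γ' = z :: γ ∧ ∀ δ : List M.Γ, δ.head? = γ.head? → M.Moves q a δ q' (z :: δ)) ∨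
    ∃ z, γ = z :: γ' ∧ ∀ δ, M.Moves q a (z :: δ) q' δ := by
  unfold Moves at *
  cases hs : M.sig a with
  | push =>
    simp only [hs] at h ⊢
    obtain ⟨z, hz, rfl⟩ := h
    exact .inr (.inl ⟨z, rfl, fun δ hδ => ⟨z, by rwa [hδ], rfl⟩⟩)
  | pop =>
    simp only [hs] at h ⊢
    obtain ⟨hq, rfl⟩ := h
    cases γ with
    | nil =>
      refine .inl ⟨rfl, fun δ hδ => ?_⟩
      obtain rfl : δ = [] := by simpa using hδ
      exact ⟨hq, by simp⟩
    | cons z γ => exact .inr (.inr ⟨z, rfl, fun δ => ⟨hq, by simp⟩⟩)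
  | keep =>
    simp only [hs] at h ⊢
    obtain ⟨hq, rfl⟩ := h
    exact .inl ⟨rfl, fun δ hδ => ⟨by rwa [hδ], trivial⟩⟩

/-! ### Every accepted word has a permutation generated by the grammar -/

variable [Finite α]

theorem mem_derivable {A : M.Nonterm} {u : List (Symbol α M.Nonterm)} (h : M.IsRule A u)
    {w : List α} (hw : Yields (derivable M.grammar) u w) : w ∈ derivable M.grammar A :=
  mem_derivable_of_yields (g := M.grammar) (r := ⟨A, u⟩) (M.finite_rules.mem_toFinset.2 h) hw

theorem mem_derivable_rest {T : Set α} {w : List α} (hw : ∀ b ∈ w, b ∈ T) :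
    w ∈ derivable M.grammar (.inr T : M.Nonterm) := by
  induction w with
  | nil => exact mem_derivable (.restNil T) .nil
  | cons b w ih =>
    simp only [List.mem_cons, forall_eq_or_imp] at hw
    exact mem_derivable (.restCons hw.1) (.terminal b (.single (ih hw.2)))

variable (M) in
/-- `M.Generated s γ w` holds if the grammar generates the word `w` as an input that leads from
the state `s` with pushdown content `γ` to acceptance. -/
inductive Generated : M.Q × Set α → List M.Γ → List α → Prop
  | opened {s : M.Q × Set α} {γ : List M.Γ} {w : List α}
      (h : w ∈ derivable M.grammar (.inl (s, γ.head?, none) : M.Nonterm)) : Generated s γ w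
  | pop {s : M.Q × Set α} {p p' : M.Q} {T : Set α} {γ : List M.Γ} {z : M.Γ} {v w : List α} {b : α}
      (hv : v ∈ derivable M.grammar (.inl (s, some z, some (p, T)) : M.Nonterm))
      (hb : b ∈ T) (hb' : b ∉ M.tau p) (h : ∀ δ, M.Moves p b (z :: δ) p' δ)
      (hw : Generated (p', T) γ w) : Generated s (z :: γ) (v ++ b :: w)

/-- A context in a sentential form that works for every target can be added in front. -/
theorem Generated.of_forall {s s' : M.Q × Set α} {γ : List M.Γ} {x w : List α}
    (h : ∀ o, ∀ w ∈ derivable M.grammar (.inl (s', γ.head?, o) : M.Nonterm),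
      x ++ w ∈ derivable M.grammar (.inl (s, γ.head?, o) : M.Nonterm))
    (hw : M.Generated s' γ w) : M.Generated s γ (x ++ w) := by
  cases hw with
  | opened hw => exact .opened (h _ _ hw)
  | pop hv hb hb' hm hw =>
    rw [← List.append_assoc]
    exact .pop (h _ _ hv) hb hb' hm hw

/-- Induction along the computation: the letter processed now is put in front of the rearranged
rest. `T` may be any set containing the remaining letters, and it shrinks at endmarker steps. -/
theorem exists_perm_generated {q : M.Q} {w : List α} {γ : List M.Γ}
    (h : Relation.ReflTransGen M.Step (.run q w γ) .accept) :
    ∀ T : Set α, (∀ b ∈ w, b ∈ T) → ∃ v, v.Perm w ∧ M.Generated (q, T) γ v := by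
  generalize hc : Config.run q w γ = c at h
  induction h using Relation.ReflTransGen.head_induction_on generalizing q w γ with
  | refl => cases hc
  | head hstep _ ih =>
    subst hc
    intro T hT
    cases hstep with
    | @letter _ q' x y a _ γ' hx ha h =>
      have haT : a ∈ T := hT a (by simp)
      obtain ⟨v, hv, hg⟩ := ih rfl T (fun b hb => hT b (by
        rcases List.mem_append.1 hb with hb | hb <;> simp [hb]))
      refine ⟨a :: v, (hv.cons a).trans List.perm_middle.symm, ?_⟩
      rcases h.cases with ⟨rfl, hm⟩ | ⟨z, rfl, hm⟩ | ⟨z, rfl, hm⟩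
      · exact hg.of_forall (x := [a]) fun o w hw =>
          mem_derivable (.stay o haT ha hm) (.terminal a (.single hw))
      -- The symbol just pushed either stays until acceptance or is popped later; in the latter case
      -- the matching letter `b` closes the segment for `pushPop`.
      · cases hg with
        | opened hv => exact .opened (mem_derivable (.pushOpen haT ha hm) (.terminal a (.single hv)))
        | @pop _ _ _ _ _ _ v w b hd hb hb' hm' hw =>
          have := hw.of_forall (x := a :: v ++ [b]) (s := (q, T)) fun o w hw => by
            simpa using mem_derivable (.pushPop o haT ha hm hb hb' hm')
              (.terminal a (.nonterminal hd (.terminal b (.single hw))))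
          simpa using this
      -- The topmost symbol is popped at once, so the segment above it is empty.
      · exact .pop (v := []) (mem_derivable (.done _ _) .nil) haT ha hm hg
    | @letterAccept _ x y a _ hx ha h =>
      refine ⟨a :: (x ++ y), List.perm_middle.symm, .opened ?_⟩
      refine mem_derivable (.letterAccept (hT a (by simp)) ha h)
        (.terminal a (.single (mem_derivable_rest fun b hb => hT b ?_)))
      rcases List.mem_append.1 hb with hb | hb <;> simp [hb]
    | endmarker hx h =>
      obtain ⟨v, hv, hg⟩ := ih rfl (T ∩ M.tau q) fun b hb => ⟨hT b hb, hx b hb⟩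
      exact ⟨v, hv, hg.of_forall (x := []) fun o w hw =>
        mem_derivable (.endmarker o h) (.single hw)⟩
    | endmarkerAccept hx h =>
      exact ⟨w, .refl _, .opened (mem_derivable (.endmarkerAccept h)
        (.single (mem_derivable_rest fun b hb => ⟨hT b hb, hx b hb⟩)))⟩

variable (M) in
theorem letterEquivalent_grammar : LetterEquivalent M.grammar.language M.language := by
  refine Set.Subset.antisymm (Set.image_mono M.grammar_language_le) ?_
  rintro _ ⟨w, hw, rfl⟩
  obtain ⟨v, hv, hg⟩ := exists_perm_generated hw Set.univ (by simp)
  generalize hγ : [] = γ at hg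
  cases hg with
  | pop => cases hγ
  | opened h =>
    subst hγ
    refine ⟨v, h, ?_⟩
    classical
    ext a
    exact hv.count_eq a

end Automaton

theorem exists_contextFree_letterEquivalent (α : Type) [Finite α] (L : Language α)
    (hL : L ∈ NIDPDAwtl α) :
    ∃ L' : Language α, L'.IsContextFree ∧ L' ≤ L ∧ LetterEquivalent L' L := by
  obtain ⟨M, rfl⟩ := hL
  exact ⟨M.grammar.language, ⟨_, rfl⟩, M.grammar_language_le, M.letterEquivalent_grammar⟩

theorem semilinear_of_mem_NIDPDAwtl (α : Type) [Finite α] (L : Language α)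
    (hL : L ∈ NIDPDAwtl α) : Semilinear L := by
  obtain ⟨L', hcf, -, heq⟩ := exists_contextFree_letterEquivalent α L hL
  unfold Semilinear
  rw [← show parikhImage L' = parikhImage L from heq]
  exact semilinear_of_isContextFree hcf

/-! ### Simulating the returning mode in the non-returning mode -/

/-- Apply a function to the targets of an action. -/
def Action.map {X Y : Type} (f : X → Y) : Action X → Action Y
  | .goto S => .goto (f '' S)
  | .accept => .accept

theorem Action.AtMostOne.map {X Y : Type} {f : X → Y} {A : Action X} (h : A.AtMostOne) :
    (A.map f).AtMostOne := by
  cases A with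
  | goto S => exact Set.Subsingleton.image h f
  | accept => trivial

@[simp] theorem Action.mem_targets_map {X Y : Type} {f : X → Y} {A : Action X} {y : Y} :
    y ∈ (A.map f).targets ↔ ∃ x ∈ A.targets, f x = y := by
  cases A <;> simp [Action.map, Action.targets]

@[simp] theorem Action.map_eq_accept {X Y : Type} {f : X → Y} {A : Action X} :
    A.map f = .accept ↔ A = .accept := by
  cases A <;> simp [Action.map]

namespace Automaton

variable {α : Type} (M : Automaton α)

/-- The automaton that simulates `M` in the non-returning mode. After each step on a letter it
enters a copy of the successor state in which all letters are translucent, so that the head returns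
to the left end. -/
def returnSimulation : Automaton α where
  Q := M.Q × Bool
  Γ := M.Γ
  finite_Q := have := M.finite_Q; inferInstance
  finite_Γ := M.finite_Γ
  start := (M.start, false)
  sig := M.sig
  tau
    | (q, false) => M.tau q
    | (_, true) => Set.univ
  deltaD p a z := (M.deltaD p.1 a z).map fun x => ((x.1, true), x.2)
  deltaR p a z := (M.deltaR p.1 a z).map fun q => (q, true)
  deltaN
    | p, some a, z => (M.deltaN p.1 (some a) z).map fun q => (q, true)
    | (q, false), none, z => (M.deltaN q none z).map fun q => (q, false)
    | (q, true), none, _ => .goto {(q, false)}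

theorem Deterministic.returnSimulation {M : Automaton α} (h : M.Deterministic) :
    M.returnSimulation.Deterministic where
  push p a z ha := (h.push p.1 a z ha).map
  pop p a z ha := (h.pop p.1 a z ha).map
  keep p a z ha := (h.keep p.1 a z ha).map
  endmarker := by
    rintro ⟨q, _ | _⟩ z
    · exact (h.endmarker q z).map
    · exact Set.subsingleton_singleton

theorem returnSimulation_moves {p p' : M.Q × Bool} {a : α} {γ γ' : List M.Γ} :
    M.returnSimulation.Moves p a γ p' γ' ↔ p'.2 = true ∧ M.Moves p.1 a γ p'.1 γ' := by
  obtain ⟨q', b⟩ := p'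
  unfold Moves
  rw [show M.returnSimulation.sig a = M.sig a from rfl]
  cases M.sig a with
  | push =>
    constructor
    · rintro ⟨z, h, rfl⟩
      obtain ⟨x, hx, hxe⟩ := Action.mem_targets_map.1 h
      cases hxe
      exact ⟨rfl, _, hx, rfl⟩
    · rintro ⟨hb, z, hz, rfl⟩
      cases hb
      exact ⟨z, Action.mem_targets_map.2 ⟨_, hz, rfl⟩, rfl⟩
  | pop =>
    constructor
    · rintro ⟨h, rfl⟩
      obtain ⟨x, hx, hxe⟩ := Action.mem_targets_map.1 h
      cases hxe
      exact ⟨rfl, hx, rfl⟩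
    · rintro ⟨hb, hz, rfl⟩
      cases hb
      exact ⟨Action.mem_targets_map.2 ⟨_, hz, rfl⟩, rfl⟩
  | keep =>
    constructor
    · rintro ⟨h, rfl⟩
      obtain ⟨x, hx, hxe⟩ := Action.mem_targets_map.1 h
      cases hxe
      exact ⟨rfl, hx, rfl⟩
    · rintro ⟨hb, hz, rfl⟩
      cases hb
      exact ⟨Action.mem_targets_map.2 ⟨_, hz, rfl⟩, rfl⟩

theorem returnSimulation_acceptsOn {p : M.Q × Bool} {a : α} {z : Option M.Γ} :
    M.returnSimulation.AcceptsOn p a z ↔ M.AcceptsOn p.1 a z := by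
  unfold AcceptsOn
  rw [show M.returnSimulation.sig a = M.sig a from rfl]
  cases M.sig a <;> simp [returnSimulation]

theorem returnSimulation_return (u w : List α) (q : M.Q) (γ : List M.Γ) :
    M.returnSimulation.NRStep (.run u (q, true) w γ) (.run [] (q, false) (u ++ w) γ) :=
  .endmarker (fun _ _ => trivial) rfl

theorem nr_of_returning {q : M.Q} {w : List α} {γ : List M.Γ}
    (h : Relation.ReflTransGen M.Step (.run q w γ) .accept) :
    Relation.ReflTransGen M.returnSimulation.NRStep (.run [] (q, false) w γ) .accept := by
  generalize hc : Config.run q w γ = c at h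
  induction h using Relation.ReflTransGen.head_induction_on generalizing q w γ with
  | refl => cases hc
  | head hstep _ ih =>
    subst hc
    cases hstep with
    | @letter _ q' x y a _ γ' hx ha h =>
      refine .head (.letter (M := M.returnSimulation) (q := (q, false)) (q' := (q', true))
        (γ' := γ') hx ha
        (M.returnSimulation_moves.2 ⟨rfl, h⟩)) (.head (M.returnSimulation_return _ _ _ _) ?_)
      simpa using ih rfl
    | letterAccept hx ha h =>
      exact .single (.letterAccept (M := M.returnSimulation) (q := (q, false)) hx ha
        (M.returnSimulation_acceptsOn.2 h))
    | @endmarker _ q' x _ hx h =>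
      exact .head (.endmarker (M := M.returnSimulation) (q := (q, false)) (q' := (q', false)) hx
        (Action.mem_targets_map.2 ⟨_, h, rfl⟩))
        (ih rfl)
    | endmarkerAccept hx h =>
      exact .single (.endmarkerAccept (M := M.returnSimulation) (q := (q, false)) hx
        (Action.map_eq_accept.2 h))

/-- The hypothesis `hu` is the invariant of the induction: only in the all-translucent copy of a
state may the head be away from the left end. -/
theorem returning_of_nr {u : List α} {p : M.returnSimulation.Q} {w : List α} {γ : List M.Γ}
    (h : Relation.ReflTransGen M.returnSimulation.NRStep (.run u p w γ) .accept)
    (hu : p.2 = false → u = []) :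
    Relation.ReflTransGen M.Step (.run p.1 (u ++ w) γ) .accept := by
  generalize hc : NRConfig.run u p w γ = c at h
  induction h using Relation.ReflTransGen.head_induction_on generalizing u p w γ with
  | refl => cases hc
  | head hstep _ ih =>
    subst hc
    obtain ⟨q, _ | _⟩ := p
    · obtain rfl := hu rfl
      cases hstep with
      | letter hx ha h =>
        obtain ⟨h1, h2⟩ := M.returnSimulation_moves.1 h
        exact .head (.letter hx ha h2) (by simpa using ih (by simp [h1]) rfl)
      | letterAccept hx ha h =>
        exact .single (.letterAccept hx ha (M.returnSimulation_acceptsOn.1 h))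
      | endmarker hx h =>
        obtain ⟨q', hq', rfl⟩ := Action.mem_targets_map.1 h
        exact .head (.endmarker hx hq') (ih (by simp) rfl)
      | endmarkerAccept hx h =>
        exact .single (.endmarkerAccept hx (Action.map_eq_accept.1 h))
    · cases hstep with
      | letter hx ha h => exact absurd trivial ha
      | letterAccept hx ha h => exact absurd trivial ha
      | @endmarker _ q' _ _ _ hx h =>
        obtain rfl : q' = (q, false) := h
        exact ih (u := []) (p := (q, false)) (w := u ++ w) (fun _ => rfl) rfl
      | endmarkerAccept hx h => cases h

theorem returnSimulation_nrLanguage : M.returnSimulation.nrLanguage = M.language :=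
  Set.Subset.antisymm (fun _ h => M.returning_of_nr h fun _ => rfl) fun _ h => M.nr_of_returning h

end Automaton

theorem DIDPDAwtl_subset_nrDIDPDAwtl (α : Type) [Finite α] : DIDPDAwtl α ⊆ nrDIDPDAwtl α := by
  rintro _ ⟨M, hM, rfl⟩
  exact ⟨_, hM.returnSimulation, M.returnSimulation_nrLanguage⟩

theorem NIDPDAwtl_subset_nrNIDPDAwtl (α : Type) [Finite α] : NIDPDAwtl α ⊆ nrNIDPDAwtl α := by
  rintro _ ⟨M, rfl⟩
  exact ⟨_, M.returnSimulation_nrLanguage⟩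

/-! ### The separating language is not semilinear -/

theorem count_a_nslPrefix (k : ℕ) : parikh (nslPrefix k) Letter.a = k ^ 2 := by
  classical
  induction k with
  | zero => simp [nslPrefix, parikh]
  | succ k ih =>
    unfold parikh nslPrefix at *
    rw [List.range_succ, List.flatMap_append, List.count_append, ih]
    simp [List.count_replicate]
    ring

theorem count_a_nslWord (k : ℕ) : parikh (nslWord k) Letter.a = (k + 1) ^ 2 := by
  classical
  cases k with
  | zero => simp [nslWord, parikh]
  | succ k =>
    have h := count_a_nslPrefix k
    unfold parikh nslWord at *
    rw [List.count_append, h]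
    simp [List.count_replicate]
    ring

theorem not_semilinear_nsl : ¬ Semilinear nsl := by
  intro h
  have h := IsSemilinearSet.image h (Pi.evalAddMonoidHom (fun _ : Letter => ℕ) Letter.a)
  rw [Nat.isSemilinearSet_iff_ultimately_periodic] at h
  have himg : ∀ x, x ∈ Pi.evalAddMonoidHom (fun _ : Letter => ℕ) Letter.a '' parikhImage nsl ↔
      ∃ k, x = (k + 1) ^ 2 := by
    intro x
    constructor
    · rintro ⟨_, ⟨_, ⟨k, rfl⟩, rfl⟩, rfl⟩
      exact ⟨k, count_a_nslWord k⟩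
    · rintro ⟨k, rfl⟩
      exact ⟨_, ⟨_, ⟨k, rfl⟩, rfl⟩, count_a_nslWord k⟩
  obtain ⟨k, p, hp, h⟩ := h
  simp only [himg] at h
  -- The gap from `(k + p + 1) ^ 2` to the next square exceeds the period `p`, so adding `p` cannot
  -- lead to a square.
  obtain ⟨j, hj⟩ := (h ((k + p + 1) ^ 2) (by nlinarith)).1 ⟨k + p, rfl⟩
  have h1 : k + p < j := by
    by_contra hle
    have : (j + 1) ^ 2 ≤ (k + p + 1) ^ 2 := Nat.pow_le_pow_left (by omega) 2
    omega
  have h2 : (k + p + 2) ^ 2 ≤ (j + 1) ^ 2 := Nat.pow_le_pow_left (by omega) 2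
  nlinarith

namespace Automaton

variable {α : Type} (M : Automaton α)

/-! ### Recursion equations for acceptance in the non-returning mode -/

/-- In the non-returning mode `M` accepts from the given configuration. -/
def NRAccepts (u : List α) (q : M.Q) (w : List α) (γ : List M.Γ) : Prop :=
  Relation.ReflTransGen M.NRStep (.run u q w γ) .accept

variable {M} {u w : List α} {q : M.Q} {a : α} {γ : List M.Γ}

theorem nrAccepts_iff_exists_step :
    M.NRAccepts u q w γ ↔ ∃ c, M.NRStep (.run u q w γ) c ∧ Relation.ReflTransGen M.NRStep c .accept
    := by
  unfold NRAccepts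
  rw [Relation.ReflTransGen.cases_head_iff]
  simp

theorem nrAccepts_nil : M.NRAccepts u q [] γ ↔
    M.deltaN q none γ.head? = .accept ∨
      ∃ q' ∈ (M.deltaN q none γ.head?).targets, M.NRAccepts [] q' u γ := by
  rw [nrAccepts_iff_exists_step]
  constructor
  · rintro ⟨c, hc, hacc⟩
    generalize hw : ([] : List α) = w at hc
    cases hc with
    | letter => simp at hw
    | letterAccept => simp at hw
    | endmarker hx h =>
      subst hw
      rw [List.append_nil] at hacc
      exact .inr ⟨_, h, hacc⟩
    | endmarkerAccept hx h => exact .inl h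
  · rintro (h | ⟨q', h, hacc⟩)
    · exact ⟨_, .endmarkerAccept (by simp) h, .refl⟩
    · refine ⟨_, .endmarker (by simp) h, ?_⟩
      rwa [List.append_nil]

/-- Skipping is not a step of its own, but the same continuations are possible whether or not the
head has already passed a translucent letter. Together with the equations for the empty rest and for
a letter that is processed, this lets `simp` run a concrete automaton letter by letter. -/
theorem nrAccepts_cons_of_mem (ha : a ∈ M.tau q) :
    M.NRAccepts u q (a :: w) γ ↔ M.NRAccepts (u ++ [a]) q w γ := by
  rw [nrAccepts_iff_exists_step, nrAccepts_iff_exists_step]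
  constructor
  · rintro ⟨c, hc, hacc⟩
    generalize hw : a :: w = v at hc
    cases hc with
    | @letter _ _ _ x y b _ _ hx hb h =>
      cases x with
      | nil =>
        cases hw
        exact absurd ha hb
      | cons b x =>
        cases hw
        refine ⟨_, .letter (fun b hb => hx b (by simp [hb])) hb h, by simpa using hacc⟩
    | @letterAccept _ _ x y b _ hx hb h =>
      cases x with
      | nil =>
        cases hw
        exact absurd ha hb
      | cons b x =>
        cases hw
        exact ⟨_, .letterAccept (fun b hb => hx b (by simp [hb])) hb h, hacc⟩
    | endmarker hx h =>
      subst hw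
      exact ⟨_, .endmarker (fun b hb => hx b (by simp [hb])) h, by simpa using hacc⟩
    | endmarkerAccept hx h =>
      subst hw
      exact ⟨_, .endmarkerAccept (fun b hb => hx b (by simp [hb])) h, hacc⟩
  · rintro ⟨c, hc, hacc⟩
    generalize hv : u ++ [a] = v at hc
    cases hc with
    | @letter _ _ _ x y b _ _ hx hb h =>
      subst hv
      exact ⟨_, .letter (x := a :: x) (by simpa [ha] using hx) hb h, by simpa using hacc⟩
    | @letterAccept _ _ x y b _ hx hb h =>
      exact ⟨_, .letterAccept (x := a :: x) (by simpa [ha] using hx) hb h, hacc⟩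
    | endmarker hx h =>
      subst hv
      exact ⟨_, .endmarker (x := a :: w) (by simpa [ha] using hx) h, by simpa using hacc⟩
    | endmarkerAccept hx h =>
      exact ⟨_, .endmarkerAccept (x := a :: w) (by simpa [ha] using hx) h, hacc⟩

theorem nrAccepts_cons_of_notMem (ha : a ∉ M.tau q) :
    M.NRAccepts u q (a :: w) γ ↔ M.AcceptsOn q a γ.head? ∨
      ∃ q' γ', M.Moves q a γ q' γ' ∧ M.NRAccepts u q' w γ' := by
  rw [nrAccepts_iff_exists_step]
  constructor
  · rintro ⟨c, hc, hacc⟩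
    generalize hw : a :: w = v at hc
    cases hc with
    | @letter _ _ _ x y b _ _ hx hb h =>
      cases x with
      | nil =>
        cases hw
        rw [List.append_nil] at hacc
        exact .inr ⟨_, _, h, hacc⟩
      | cons b x =>
        cases hw
        exact absurd (hx a (by simp)) ha
    | @letterAccept _ _ x y b _ hx hb h =>
      cases x with
      | nil =>
        cases hw
        exact .inl h
      | cons b x =>
        cases hw
        exact absurd (hx a (by simp)) ha
    | endmarker hx h =>
      subst hw
      exact absurd (hx a (by simp)) ha
    | endmarkerAccept hx h =>
      subst hw
      exact absurd (hx a (by simp)) ha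
  · rintro (h | ⟨q', γ', h, hacc⟩)
    · exact ⟨_, .letterAccept (x := []) (by simp) ha h, .refl⟩
    · refine ⟨_, .letter (x := []) (by simp) ha h, ?_⟩
      rwa [List.append_nil]

end Automaton

/-! ### A deterministic automaton for the separating language -/

/-- The states of the automaton for `nsl`. The first sweep (`init` to `final`) checks that the input
has the form `a $ # #* a (a* $ # #* a)* a* $ ¢ ¢* a a*`, and every further sweep (`start` to
`final`) checks that the remaining input has the form `a a # (#* a a a* #)* #* a a a* ¢ ¢* a a a*`
or `a a ¢ ¢* a a a*`. The letters that are not starred in these expressions are deleted. -/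
inductive NslState where
  | init | first | separator | hash | block | cent
  | start | start' | start'' | hash₂ | hash₂' | block₂ | cent₂ | cent₂' | final

/-- The successor state on an input letter. -/
def NslState.next : NslState → Letter → Option NslState
  | .init, .a => some .first
  | .first, .dollar => some .separator
  | .separator, .hash => some .hash
  | .separator, .cent => some .cent
  | .hash, .a => some .block
  | .block, .dollar => some .separator
  | .cent, .a => some .final
  | .start, .a => some .start'
  | .start', .a => some .start''
  | .start'', .hash => some .hash₂
  | .start'', .cent => some .cent₂
  | .hash₂, .a => some .hash₂'
  | .hash₂', .a => some .block₂
  | .block₂, .hash => some .hash₂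
  | .block₂, .cent => some .cent₂
  | .cent₂, .a => some .cent₂'
  | .cent₂', .a => some .final
  | _, _ => none

instance : Finite NslState :=
  Finite.of_surjective (fun i : Fin 15 => ![NslState.init, .first, .separator, .hash, .block, .cent,
    .start, .start', .start'', .hash₂, .hash₂', .block₂, .cent₂, .cent₂', .final] i) fun x => by
    cases x
    exacts [⟨0, rfl⟩, ⟨1, rfl⟩, ⟨2, rfl⟩, ⟨3, rfl⟩, ⟨4, rfl⟩, ⟨5, rfl⟩, ⟨6, rfl⟩, ⟨7, rfl⟩, ⟨8, rfl⟩,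
      ⟨9, rfl⟩, ⟨10, rfl⟩, ⟨11, rfl⟩, ⟨12, rfl⟩, ⟨13, rfl⟩, ⟨14, rfl⟩]

/-- The action on the endmarker. -/
def NslState.onEndmarker : NslState → Option Unit → Action NslState
  | .first, none => .accept
  | .start'', none => .accept
  | .final, _ => .goto {.start}
  | _, _ => .goto ∅

/-- The automaton for `nsl`. The separators `$` are pushed in the first sweep, and every sweep pops
one of them with a letter `¢`, so that there are as many sweeps as separators. -/
def nslAutomaton : Automaton Letter where
  Q := NslState
  Γ := Unit
  finite_Q := inferInstance
  finite_Γ := inferInstance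
  start := .init
  sig
    | .dollar => .push
    | .cent => .pop
    | _ => .keep
  tau
    | .hash | .hash₂ => {.hash}
    | .block | .block₂ | .final => {.a}
    | .cent | .cent₂ => {.cent}
    | _ => ∅
  deltaD q x _ := .goto {p | q.next x = some p.1}
  deltaR q x z := .goto {p | z ≠ none ∧ q.next x = some p}
  deltaN
    | q, some x, _ => .goto {p | q.next x = some p}
    | q, none, z => q.onEndmarker z

theorem nslAutomaton_deterministic : nslAutomaton.Deterministic where
  push q x z _ := fun p hp p' hp' =>
    Prod.ext (Option.some.inj ((show q.next x = some p.1 from hp).symm.trans hp')) rfl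
  pop q x z _ := fun p hp p' hp' => Option.some.inj (hp.2.symm.trans hp'.2)
  keep q x z _ := fun p hp p' hp' =>
    Option.some.inj ((show q.next x = some p from hp).symm.trans hp')
  endmarker q z := by
    cases q <;> cases z <;> simp [nslAutomaton, NslState.onEndmarker, Action.AtMostOne]

/-! ### Acceptance equations for the automaton for `nsl` -/

namespace Nsl

/-- Acceptance by the automaton for `nsl` with `n` symbols in the pushdown store. -/
def Acc (u : List Letter) (q : NslState) (w : List Letter) (n : ℕ) : Prop :=
  nslAutomaton.NRAccepts u q w (List.replicate n ())

variable {u w : List Letter} {q : NslState} {n : ℕ}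

theorem onEndmarker_eq_accept {z : Option Unit} :
    q.onEndmarker z = .accept ↔ z = none ∧ (q = .first ∨ q = .start'') := by
  cases q <;> cases z <;> simp [NslState.onEndmarker]

theorem mem_targets_onEndmarker {z : Option Unit} {q' : NslState} :
    q' ∈ (q.onEndmarker z).targets ↔ q = .final ∧ q' = .start := by
  cases q <;> cases z <;> simp [NslState.onEndmarker, Action.targets]

theorem acc_nil (hq : q ≠ .final) : Acc u q [] n ↔ n = 0 ∧ (q = .first ∨ q = .start'') := by
  refine Automaton.nrAccepts_nil.trans ⟨?_, fun ⟨hn, h⟩ => .inl ?_⟩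
  · rintro (h | ⟨q', hq', h⟩)
    · obtain ⟨hn, h⟩ := onEndmarker_eq_accept.1 h
      refine ⟨?_, h⟩
      cases n with
      | zero => rfl
      | succ n => cases hn
    · exact absurd (mem_targets_onEndmarker.1 hq').1 hq
  · subst hn
    exact onEndmarker_eq_accept.2 ⟨rfl, h⟩

theorem acc_final_nil : Acc u .final [] n ↔ Acc [] .start u n := by
  refine Automaton.nrAccepts_nil.trans ⟨?_, fun h => .inr ⟨NslState.start,
    (mem_targets_onEndmarker (z := (List.replicate n ()).head?)).2 ⟨rfl, rfl⟩, h⟩⟩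
  rintro (h | ⟨q', hq', h⟩)
  · cases h
  · obtain ⟨-, rfl⟩ :=
      (mem_targets_onEndmarker (q := .final) (z := (List.replicate n ()).head?)).1 hq'
    exact h

theorem acc_skip {x : Letter} (h : x ∈ nslAutomaton.tau q) :
    Acc u q (x :: w) n ↔ Acc (u ++ [x]) q w n :=
  Automaton.nrAccepts_cons_of_mem h

theorem acc_skips {x : Letter} (h : x ∈ nslAutomaton.tau q) (k : ℕ) :
    Acc u q (List.replicate k x ++ w) n ↔ Acc (u ++ List.replicate k x) q w n := by
  induction k generalizing u with
  | zero => simp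
  | succ k ih => simp [List.replicate_succ, acc_skip h, ih]

theorem acc_a (h : Letter.a ∉ nslAutomaton.tau q) :
    Acc u q (.a :: w) n ↔ ∃ q', q.next .a = some q' ∧ Acc u q' w n := by
  refine (Automaton.nrAccepts_cons_of_notMem h).trans ⟨?_, ?_⟩
  · rintro (h | ⟨q', γ, ⟨h, rfl⟩, hacc⟩)
    · cases h
    · exact ⟨q', h, hacc⟩
  · rintro ⟨q', h, hacc⟩
    exact .inr ⟨q', _, ⟨h, rfl⟩, hacc⟩

theorem acc_hash (h : Letter.hash ∉ nslAutomaton.tau q) :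
    Acc u q (.hash :: w) n ↔ ∃ q', q.next .hash = some q' ∧ Acc u q' w n := by
  refine (Automaton.nrAccepts_cons_of_notMem h).trans ⟨?_, ?_⟩
  · rintro (h | ⟨q', γ, ⟨h, rfl⟩, hacc⟩)
    · cases h
    · exact ⟨q', h, hacc⟩
  · rintro ⟨q', h, hacc⟩
    exact .inr ⟨q', _, ⟨h, rfl⟩, hacc⟩

theorem acc_dollar (h : Letter.dollar ∉ nslAutomaton.tau q) :
    Acc u q (.dollar :: w) n ↔ ∃ q', q.next .dollar = some q' ∧ Acc u q' w (n + 1) := by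
  refine (Automaton.nrAccepts_cons_of_notMem h).trans ⟨?_, ?_⟩
  · rintro (h | ⟨q', γ, ⟨_, h, rfl⟩, hacc⟩)
    · cases h
    · exact ⟨q', h, hacc⟩
  · rintro ⟨q', h, hacc⟩
    exact .inr ⟨q', _, ⟨(), h, rfl⟩, hacc⟩

theorem acc_cent (h : Letter.cent ∉ nslAutomaton.tau q) :
    Acc u q (.cent :: w) n ↔ ∃ m, n = m + 1 ∧ ∃ q', q.next .cent = some q' ∧ Acc u q' w m := by
  refine (Automaton.nrAccepts_cons_of_notMem h).trans ⟨?_, ?_⟩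
  · rintro (h | ⟨q', γ, ⟨h, rfl⟩, hacc⟩)
    · cases h
    · cases n with
      | zero => exact absurd rfl h.1
      | succ n => exact ⟨n, rfl, q', h.2, hacc⟩
  · rintro ⟨n, rfl, q', h, hacc⟩
    exact .inr ⟨q', _, ⟨⟨nofun, h⟩, rfl⟩, hacc⟩

end Nsl

namespace Nsl

open List (replicate)

variable {u w : List Letter} {q : NslState} {n : ℕ}

/-! ### Words of blocks -/

/-- The word `a^i₁ #^j₁ ⋯ a^iₘ #^jₘ a^p ¢^c a^t`, where `l` lists the pairs `(i₁, j₁), …`. -/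
def blockWord : List (ℕ × ℕ) → ℕ → ℕ → ℕ → List Letter
  | [], p, c, t => replicate p .a ++ (replicate c .cent ++ replicate t .a)
  | x :: l, p, c, t => replicate x.1 .a ++ (replicate x.2 .hash ++ blockWord l p c t)

/-- The word `a^i₁ $ #^j₁ ⋯ a^iₘ $ #^jₘ a^p $ ¢^c a^t`, where `l` lists the pairs `(i₁, j₁), …`. -/
def dollarWord : List (ℕ × ℕ) → ℕ → ℕ → ℕ → List Letter
  | [], p, c, t => replicate p .a ++ .dollar :: (replicate c .cent ++ replicate t .a)
  | x :: l, p, c, t => replicate x.1 .a ++ .dollar :: (replicate x.2 .hash ++ dollarWord l p c t)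

/-- The words that are processed in the first sweep from the state `block` on. -/
def sweepWord₁ : List (ℕ × ℕ) → ℕ → ℕ → ℕ → List Letter
  | [], p, c, t => replicate p .a ++ .dollar :: .cent :: (replicate c .cent ++
      .a :: replicate t .a)
  | x :: l, p, c, t => replicate x.1 .a ++ .dollar :: .hash :: (replicate x.2 .hash ++
      .a :: sweepWord₁ l p c t)

/-- The words that are processed in a later sweep from the state `block₂` on. -/
def sweepWord₂ : List (ℕ × ℕ) → ℕ → ℕ → ℕ → List Letter
  | [], p, c, t => replicate p .a ++ .cent :: (replicate c .cent ++ .a :: .a :: replicate t .a)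
  | x :: l, p, c, t => replicate x.1 .a ++ .hash :: (replicate x.2 .hash ++
      .a :: .a :: sweepWord₂ l p c t)

/-- The parameters of `sweepWord₁` count the letters that survive the sweep. Regrouping the deleted
ones into the blocks gives the lengths before the sweep, one larger throughout; in a later sweep two
letters `a` are lost per block. -/
theorem a_sweepWord₁ (l : List (ℕ × ℕ)) (p c t : ℕ) : .a :: sweepWord₁ l p c t =
    dollarWord (l.map fun x => (x.1 + 1, x.2 + 1)) (p + 1) (c + 1) (t + 1) := by
  induction l with
  | nil => simp [sweepWord₁, dollarWord, List.replicate_succ]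
  | cons x l ih => simp [sweepWord₁, dollarWord, List.replicate_succ, ih]

theorem a_a_sweepWord₂ (l : List (ℕ × ℕ)) (p c t : ℕ) : .a :: .a :: sweepWord₂ l p c t =
    blockWord (l.map fun x => (x.1 + 2, x.2 + 1)) (p + 2) (c + 1) (t + 2) := by
  induction l with
  | nil => simp [sweepWord₂, blockWord, List.replicate_succ]
  | cons x l ih => simp [sweepWord₂, blockWord, List.replicate_succ, ih]

/-! ### The sweeps -/

theorem exists_replicate_append (x : Letter) (w : List Letter) :
    ∃ j v, w = replicate j x ++ v ∧ v.head? ≠ some x := by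
  induction w with
  | nil => exact ⟨0, [], rfl, by simp⟩
  | cons y w ih =>
    by_cases h : y = x
    · obtain ⟨j, v, rfl, hv⟩ := ih
      exact ⟨j + 1, v, by simp [List.replicate_succ, h], hv⟩
    · exact ⟨0, y :: w, rfl, by simpa using h⟩

theorem tau_mem_iff {x : Letter} : x ∈ nslAutomaton.tau q ↔
    (x = .hash ∧ (q = .hash ∨ q = .hash₂)) ∨
    (x = .a ∧ (q = .block ∨ q = .block₂ ∨ q = .final)) ∨
    (x = .cent ∧ (q = .cent ∨ q = .cent₂)) := by
  cases q <;> simp [nslAutomaton]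

theorem Acc.exists_skip {x : Letter} (hx : x ∈ nslAutomaton.tau q) (h : Acc u q w n) :
    ∃ j v, w = replicate j x ++ v ∧ v.head? ≠ some x ∧ Acc (u ++ replicate j x) q v n := by
  obtain ⟨j, v, rfl, hv⟩ := exists_replicate_append x w
  exact ⟨j, v, rfl, hv, (acc_skips hx j).1 h⟩

theorem acc_final_iff : Acc u .final w n ↔ ∃ t, w = replicate t .a ∧
    Acc [] .start (u ++ replicate t .a) n := by
  constructor
  · intro h
    obtain ⟨t, v, rfl, hv, h⟩ := h.exists_skip (x := .a) (by simp [tau_mem_iff])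
    refine ⟨t, ?_⟩
    rcases v with _ | ⟨_ | _ | _ | _, v⟩ <;>
      simp_all [acc_final_nil, acc_hash, acc_dollar, acc_cent, tau_mem_iff, NslState.next]
  · rintro ⟨t, rfl, h⟩
    rw [← List.append_nil (replicate t _), acc_skips (by simp [tau_mem_iff])]
    simpa [acc_final_nil] using h

/-- The surviving letters are what the next sweep sees. Each sweep deletes a single `¢`, which pops
one symbol. -/
theorem acc_block₂_sweepWord₂ {l : List (ℕ × ℕ)} {p c t : ℕ} :
    Acc u .block₂ (sweepWord₂ l p c t) (n + 1) ↔ Acc [] .start (u ++ blockWord l p c t) n := by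
  induction l generalizing u with
  | nil =>
    simp [sweepWord₂, blockWord, acc_skips, acc_a, acc_cent, tau_mem_iff, NslState.next,
      acc_final_iff]
  | cons x l ih =>
    simp [sweepWord₂, blockWord, acc_skips, acc_a, acc_hash, tau_mem_iff, NslState.next, ih]

/-- The sweep pushes `l.length + 1` separators `$` and pops one symbol with `¢`. -/
theorem acc_block_sweepWord₁ {l : List (ℕ × ℕ)} {p c t : ℕ} :
    Acc u .block (sweepWord₁ l p c t) n ↔
      Acc [] .start (u ++ blockWord l p c t) (n + l.length) := by
  induction l generalizing u n with
  | nil =>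
    simp [sweepWord₁, blockWord, acc_skips, acc_a, acc_cent, acc_dollar, tau_mem_iff,
      NslState.next, acc_final_iff]
  | cons x l ih =>
    simp [sweepWord₁, blockWord, acc_skips, acc_a, acc_hash, acc_dollar, tau_mem_iff,
      NslState.next, ih, add_assoc, add_comm 1]

theorem Acc.exists_of_cent₂ (h : Acc u .cent₂ w n) : ∃ c t,
    w = replicate c .cent ++ .a :: .a :: replicate t .a ∧
      Acc [] .start (u ++ (replicate c .cent ++ replicate t .a)) n := by
  obtain ⟨c, v, rfl, hv, h⟩ := h.exists_skip (x := .cent) (by simp [tau_mem_iff])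
  rcases v with _ | ⟨_ | _ | _ | _, v⟩ <;>
    simp_all [acc_nil, acc_a, acc_hash, acc_dollar, tau_mem_iff, NslState.next]
  rcases v with _ | ⟨_ | _ | _ | _, v⟩ <;>
    simp_all [acc_nil, acc_a, acc_hash, acc_dollar, acc_cent, tau_mem_iff, NslState.next,
      acc_final_iff]
  obtain ⟨t, rfl, ht⟩ := h
  exact ⟨c, t, rfl, ht⟩

theorem Acc.exists_of_hash₂ (h : Acc u .hash₂ w n) : ∃ j v,
    w = replicate j .hash ++ .a :: .a :: v ∧ Acc (u ++ replicate j .hash) .block₂ v n := by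
  obtain ⟨j, v, rfl, hv, h⟩ := h.exists_skip (x := .hash) (by simp [tau_mem_iff])
  rcases v with _ | ⟨_ | _ | _ | _, v⟩ <;>
    simp_all [acc_nil, acc_a, acc_cent, acc_dollar, tau_mem_iff, NslState.next]
  rcases v with _ | ⟨_ | _ | _ | _, v⟩ <;>
    simp_all [acc_nil, acc_a, acc_hash, acc_dollar, acc_cent, tau_mem_iff, NslState.next]
  exact ⟨j, v, rfl, h⟩

theorem Acc.exists_of_cent (h : Acc u .cent w n) : ∃ c t,
    w = replicate c .cent ++ .a :: replicate t .a ∧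
      Acc [] .start (u ++ (replicate c .cent ++ replicate t .a)) n := by
  obtain ⟨c, v, rfl, hv, h⟩ := h.exists_skip (x := .cent) (by simp [tau_mem_iff])
  rcases v with _ | ⟨_ | _ | _ | _, v⟩ <;>
    simp_all [acc_nil, acc_a, acc_hash, acc_dollar, tau_mem_iff, NslState.next, acc_final_iff]
  obtain ⟨t, rfl, ht⟩ := h
  exact ⟨c, t, rfl, ht⟩

theorem Acc.exists_of_hash (h : Acc u .hash w n) : ∃ j v,
    w = replicate j .hash ++ .a :: v ∧ Acc (u ++ replicate j .hash) .block v n := by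
  obtain ⟨j, v, rfl, hv, h⟩ := h.exists_skip (x := .hash) (by simp [tau_mem_iff])
  rcases v with _ | ⟨_ | _ | _ | _, v⟩ <;>
    simp_all [acc_nil, acc_a, acc_cent, acc_dollar, tau_mem_iff, NslState.next]
  exact ⟨j, v, rfl, h⟩

/-- From `block₂` the sweep passes `#` separators until it meets `¢`, and all other continuations
are dead ends. The pushdown is nonempty because `¢` must pop a symbol. -/
theorem Acc.exists_sweepWord₂ (h : Acc u .block₂ w n) :
    ∃ l p c t m, w = sweepWord₂ l p c t ∧ n = m + 1 := by
  induction hw : w.length using Nat.strong_induction_on generalizing u w with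
  | _ k ih =>
    obtain ⟨i, v, rfl, hv, h⟩ := h.exists_skip (x := .a) (by simp [tau_mem_iff])
    rcases v with _ | ⟨_ | _ | _ | _, v⟩
    · simp [acc_nil] at h
    · simp at hv
    · simp [acc_dollar, tau_mem_iff, NslState.next] at h
    · rw [acc_hash (by simp [tau_mem_iff])] at h
      obtain ⟨_, ⟨⟩, h⟩ := h
      obtain ⟨j, v, rfl, hj⟩ := h.exists_of_hash₂
      obtain ⟨l, p, c, t, m, rfl, rfl⟩ := ih v.length (by simp at hw; omega) hj rfl
      exact ⟨(i, j) :: l, p, c, t, m, rfl, rfl⟩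
    · rw [acc_cent (by simp [tau_mem_iff])] at h
      obtain ⟨m, rfl, _, ⟨⟩, h⟩ := h
      obtain ⟨c, t, rfl, -⟩ := h.exists_of_cent₂
      exact ⟨[], i, c, t, m, rfl, rfl⟩

theorem Acc.exists_sweepWord₁ (h : Acc u .block w n) : ∃ l p c t, w = sweepWord₁ l p c t := by
  induction hw : w.length using Nat.strong_induction_on generalizing u w n with
  | _ k ih =>
    obtain ⟨i, v, rfl, hv, h⟩ := h.exists_skip (x := .a) (by simp [tau_mem_iff])
    rcases v with _ | ⟨_ | _ | _ | _, v⟩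
    · simp [acc_nil] at h
    · simp at hv
    · rw [acc_dollar (by simp [tau_mem_iff])] at h
      obtain ⟨_, ⟨⟩, h⟩ := h
      rcases v with _ | ⟨_ | _ | _ | _, v⟩
      · simp [acc_nil] at h
      · simp [acc_a, tau_mem_iff, NslState.next] at h
      · simp [acc_dollar, tau_mem_iff, NslState.next] at h
      · rw [acc_hash (by simp [tau_mem_iff])] at h
        obtain ⟨_, ⟨⟩, h⟩ := h
        obtain ⟨j, v, rfl, hj⟩ := h.exists_of_hash
        obtain ⟨l, p, c, t, rfl⟩ := ih v.length (by simp at hw; omega) hj rfl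
        exact ⟨(i, j) :: l, p, c, t, rfl⟩
      · rw [acc_cent (by simp [tau_mem_iff])] at h
        obtain ⟨m, -, _, ⟨⟩, h⟩ := h
        obtain ⟨c, t, rfl, -⟩ := h.exists_of_cent
        exact ⟨[], i, c, t, rfl⟩
    · simp [acc_hash, tau_mem_iff, NslState.next] at h
    · simp [acc_cent, tau_mem_iff, NslState.next] at h

theorem acc_start_hash : ¬ Acc u .start (.hash :: w) n := by
  simp [acc_hash, tau_mem_iff, NslState.next]

theorem acc_start_cent : ¬ Acc u .start (.cent :: w) n := by
  simp [acc_cent, tau_mem_iff, NslState.next]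

/-- The input is shorter by one block after a sweep. -/
theorem acc_start_succ_iff : Acc [] .start w (n + 1) ↔
    (∃ t, w = blockWord [] 2 1 (t + 2) ∧ Acc [] .start (replicate t .a) n) ∨
    ∃ l p c t, w = blockWord ((2, 1) :: l.map fun x => (x.1 + 2, x.2 + 1)) (p + 2) (c + 1) (t + 2) ∧
      Acc [] .start (blockWord l p c t) n := by
  constructor
  · intro h
    -- The states `start`, `start'` and `start''` skip nothing, so the word must begin with `a a #`
    -- or `a a ¢`.
    rcases w with _ | ⟨_ | _ | _ | _, w⟩ <;>
      simp [acc_nil, acc_a, acc_hash, acc_dollar, acc_cent, tau_mem_iff, NslState.next] at h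
    rcases w with _ | ⟨_ | _ | _ | _, w⟩ <;>
      simp [acc_nil, acc_a, acc_hash, acc_dollar, acc_cent, tau_mem_iff, NslState.next] at h
    rcases w with _ | ⟨_ | _ | _ | _, w⟩ <;>
      simp [acc_nil, acc_a, acc_hash, acc_dollar, acc_cent, tau_mem_iff, NslState.next] at h
    · obtain ⟨j, v, rfl, hj⟩ := h.exists_of_hash₂
      obtain ⟨l, p, c, t, _, rfl, -⟩ := hj.exists_sweepWord₂
      rw [acc_block₂_sweepWord₂] at hj
      cases j with
      | zero =>
        refine .inr ⟨l, p, c, t, ?_, hj⟩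
        simp [blockWord, a_a_sweepWord₂, List.replicate_succ]
      -- A letter `#` left at the front would block the next sweep, so the first separator is a
      -- single `#`.
      | succ j => exact absurd hj acc_start_hash
    · obtain ⟨c, t, rfl, hc⟩ := h.exists_of_cent₂
      cases c with
      | zero => exact .inl ⟨t, by simp [blockWord, List.replicate_succ], hc⟩
      | succ c => exact absurd hc acc_start_cent
  · rintro (⟨t, rfl, h⟩ | ⟨l, p, c, t, rfl, h⟩)
    · simpa [blockWord, List.replicate_succ, acc_a, acc_cent, tau_mem_iff, NslState.next,
        acc_final_iff] using h
    · rw [blockWord, ← a_a_sweepWord₂]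
      simpa [List.replicate_succ, acc_a, acc_hash, tau_mem_iff, NslState.next,
        acc_block₂_sweepWord₂] using h

theorem acc_start_zero_iff : Acc [] .start w 0 ↔ w = [.a, .a] := by
  constructor
  · intro h
    rcases w with _ | ⟨_ | _ | _ | _, w⟩ <;>
      simp [acc_nil, acc_a, acc_hash, acc_dollar, acc_cent, tau_mem_iff, NslState.next] at h
    rcases w with _ | ⟨_ | _ | _ | _, w⟩ <;>
      simp [acc_nil, acc_a, acc_hash, acc_dollar, acc_cent, tau_mem_iff, NslState.next] at h
    rcases w with _ | ⟨_ | _ | _ | _, w⟩ <;>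
      simp [acc_nil, acc_a, acc_hash, acc_dollar, acc_cent, tau_mem_iff, NslState.next] at h ⊢
    obtain ⟨j, v, rfl, hj⟩ := h.exists_of_hash₂
    obtain ⟨l, p, c, t, m, -, hm⟩ := hj.exists_sweepWord₂
    cases hm
  · rintro rfl
    simp [acc_nil, acc_a, tau_mem_iff, NslState.next]

/-- The effect of the first sweep. -/
theorem acc_init_iff : Acc [] .init w 0 ↔ w = [.a] ∨ w = dollarWord [] 1 1 3 ∨
    ∃ l p c t, w = dollarWord ((1, 1) :: l.map fun x => (x.1 + 1, x.2 + 1)) (p + 1) (c + 1) (t + 1) ∧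
      Acc [] .start (blockWord l p c t) (l.length + 1) := by
  constructor
  · intro h
    rcases w with _ | ⟨_ | _ | _ | _, w⟩ <;>
      simp [acc_nil, acc_a, acc_hash, acc_dollar, acc_cent, tau_mem_iff, NslState.next] at h
    rcases w with _ | ⟨_ | _ | _ | _, w⟩ <;>
      simp [acc_nil, acc_a, acc_hash, acc_dollar, acc_cent, tau_mem_iff, NslState.next] at h
    · exact .inl rfl
    rcases w with _ | ⟨_ | _ | _ | _, w⟩ <;>
      simp [acc_nil, acc_a, acc_hash, acc_dollar, acc_cent, tau_mem_iff, NslState.next] at h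
    · obtain ⟨j, v, rfl, hj⟩ := h.exists_of_hash
      obtain ⟨l, p, c, t, rfl⟩ := hj.exists_sweepWord₁
      rw [acc_block_sweepWord₁] at hj
      cases j with
      | zero =>
        refine .inr (.inr ⟨l, p, c, t, ?_, by rwa [add_comm]⟩)
        simp [dollarWord, a_sweepWord₁, List.replicate_succ]
      | succ j => exact absurd hj acc_start_hash
    · obtain ⟨c, t, rfl, hc⟩ := h.exists_of_cent
      cases c with
      | zero =>
        -- One `$` was pushed and one `¢` popped, so the pushdown is empty and only `a a` may
        -- remain.
        obtain rfl : t = 2 := by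
          simpa using congrArg List.length (acc_start_zero_iff.1 hc)
        exact .inr (.inl rfl)
      | succ c => exact absurd hc acc_start_cent
  · rintro (rfl | rfl | ⟨l, p, c, t, rfl, h⟩)
    · simp [acc_nil, acc_a, tau_mem_iff, NslState.next]
    · have h : Acc [] .start (replicate 2 .a) 0 := acc_start_zero_iff.2 rfl
      simpa [dollarWord, List.replicate_succ, acc_skip, acc_a, acc_cent, acc_dollar, tau_mem_iff,
        NslState.next, acc_final_nil] using h
    · rw [dollarWord, ← a_sweepWord₁]
      simpa [List.replicate_succ, acc_a, acc_hash, acc_dollar, tau_mem_iff, NslState.next,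
        acc_block_sweepWord₁, add_comm] using h

/-! ### Block words with a minimal number of blocks -/

/-- The number of places where a letter other than `a` follows a letter `a`; the Boolean tells
whether the word itself is preceded by an `a`. -/
def descents : Bool → List Letter → ℕ
  | _, [] => 0
  | _, .a :: w => descents true w
  | b, _ :: w => b.toNat + descents false w

theorem descents_replicate_a (b : Bool) (i : ℕ) (w : List Letter) :
    descents b (replicate i .a ++ w) = descents (b || decide (0 < i)) w := by
  induction i generalizing b with
  | zero => simp
  | succ i ih => simp [List.replicate_succ, descents, ih]

theorem descents_replicate {x : Letter} (hx : x ≠ .a) (b : Bool) (j : ℕ) (w : List Letter) :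
    descents b (replicate (j + 1) x ++ w) = b.toNat + descents false w := by
  induction j generalizing b with
  | zero => cases x <;> simp_all [descents]
  | succ j ih =>
    rw [List.replicate_succ, List.cons_append]
    cases x <;> simp_all [descents]

theorem descents_replicate_a_nil (b : Bool) (i : ℕ) : descents b (replicate i .a) = 0 := by
  simpa [descents] using descents_replicate_a b i []

/-- Each run of `#` or `¢` contributes at most one descent, at its first letter, and the final run
of `a` contributes none. -/
theorem descents_blockWord_le (b : Bool) (l : List (ℕ × ℕ)) (p c t : ℕ) :
    descents b (blockWord l p c t) ≤ l.length + 1 := by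
  induction l generalizing b with
  | nil =>
    rw [blockWord, descents_replicate_a]
    cases c with
    | zero => simp [descents_replicate_a_nil]
    | succ c =>
      rw [descents_replicate (by simp), descents_replicate_a_nil]
      exact Bool.toNat_le _
  | cons x l ih =>
    obtain ⟨i, j⟩ := x
    rw [blockWord, descents_replicate_a]
    cases j with
    | zero => exact (ih _).trans (by simp)
    | succ j =>
      rw [descents_replicate (by simp), List.length_cons]
      have := ih false
      have := Bool.toNat_le (b || decide (0 < i))
      dsimp only at *
      omega

/-- An empty separator has no descent, and one after an empty first block has none either. An empty
inner block follows a separator directly and so loses the descent of the next one. Hence the bound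
is attained only without empty parts. -/
theorem pos_of_descents_blockWord {l : List (ℕ × ℕ)} {p c t : ℕ}
    (h : descents false (blockWord l p c t) = l.length + 1) :
    (∀ x ∈ l, 0 < x.1 ∧ 0 < x.2) ∧ 0 < p ∧ 0 < c := by
  induction l with
  | nil =>
    rw [blockWord, descents_replicate_a] at h
    cases c with
    | zero => simp [descents_replicate_a_nil] at h
    | succ c =>
      rw [descents_replicate (by simp), descents_replicate_a_nil] at h
      cases p <;> simp_all
  | cons x l ih =>
    obtain ⟨i, j⟩ := x
    rw [blockWord, descents_replicate_a] at h
    cases j with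
    | zero =>
      have := descents_blockWord_le (false || decide (0 < i)) l p c t
      simp at h this
      omega
    | succ j =>
      rw [descents_replicate (by simp), List.length_cons] at h
      have hle := descents_blockWord_le false l p c t
      cases i with
      | zero =>
        simp at h
        omega
      | succ i =>
        simp only [Nat.zero_lt_succ, decide_true, Bool.or_true, Bool.toNat_true] at h
        obtain ⟨h1, h2⟩ := ih (by omega)
        exact ⟨by simpa using h1, h2⟩

theorem descents_blockWord_of_pos {l : List (ℕ × ℕ)} {p c t : ℕ}
    (hl : ∀ x ∈ l, 0 < x.1 ∧ 0 < x.2) (hp : 0 < p) (hc : 0 < c) :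
    descents false (blockWord l p c t) = l.length + 1 := by
  induction l with
  | nil =>
    obtain ⟨c, rfl⟩ := Nat.exists_eq_succ_of_ne_zero hc.ne'
    rw [blockWord, descents_replicate_a, descents_replicate (by simp), descents_replicate_a_nil]
    simp [hp]
  | cons x l ih =>
    obtain ⟨i, j⟩ := x
    simp only [List.mem_cons, forall_eq_or_imp] at hl
    obtain ⟨j, rfl⟩ := Nat.exists_eq_succ_of_ne_zero hl.1.2.ne'
    rw [blockWord, descents_replicate_a, descents_replicate (by simp), ih hl.2]
    simp [hl.1.1, add_comm]

theorem replicate_append_inj {x : Letter} {i j : ℕ} {v w : List Letter} (hv : v.head? ≠ some x)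
    (hw : w.head? ≠ some x) (h : replicate i x ++ v = replicate j x ++ w) : i = j ∧ v = w := by
  induction i generalizing j with
  | zero =>
    cases j with
    | zero => exact ⟨rfl, h⟩
    | succ j =>
      subst h
      simp [List.replicate_succ] at hv
  | succ i ih =>
    cases j with
    | zero =>
      rw [List.replicate_zero, List.nil_append] at h
      subst h
      simp [List.replicate_succ] at hw
    | succ j =>
      simp only [List.replicate_succ, List.cons_append, List.cons.injEq, true_and] at h
      obtain ⟨rfl, rfl⟩ := ih h
      exact ⟨rfl, rfl⟩

theorem head?_replicate_append {x : Letter} {i : ℕ} (hi : 0 < i) (w : List Letter) :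
    (replicate i x ++ w).head? = some x := by
  obtain ⟨i, rfl⟩ := Nat.exists_eq_succ_of_ne_zero hi.ne'
  simp [List.replicate_succ]

theorem head?_blockWord {l : List (ℕ × ℕ)} {p c t : ℕ} (hl : ∀ x ∈ l, 0 < x.1 ∧ 0 < x.2)
    (hp : 0 < p) : (blockWord l p c t).head? = some .a := by
  cases l with
  | nil => exact head?_replicate_append hp _
  | cons x l => exact head?_replicate_append (hl x (by simp)).1 _

/-- With nonempty parts, the block lengths are the lengths of the maximal runs of the word. Only the
last block may be empty. -/
theorem blockWord_inj {l l' : List (ℕ × ℕ)} {p c t p' c' t' : ℕ}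
    (hlen : l.length = l'.length)
    (hl : ∀ x ∈ l, 0 < x.1 ∧ 0 < x.2) (hp : 0 < p) (hc : 0 < c)
    (hl' : ∀ x ∈ l', 0 < x.1 ∧ 0 < x.2) (hp' : 0 < p') (hc' : 0 < c')
    (h : blockWord l p c t = blockWord l' p' c' t') : l = l' ∧ p = p' ∧ c = c' ∧ t = t' := by
  induction l generalizing l' with
  | nil =>
    obtain rfl := List.length_eq_zero_iff.1 hlen.symm
    have hhead (t : ℕ) : (replicate t Letter.a).head? ≠ some .cent := by
      cases t <;> simp [List.replicate_succ]
    obtain ⟨h1, h⟩ := replicate_append_inj (by simp [head?_replicate_append hc])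
      (by simp [head?_replicate_append hc']) h
    obtain ⟨h2, h⟩ := replicate_append_inj (hhead t) (hhead t') h
    exact ⟨rfl, h1, h2, by simpa using congrArg List.length h⟩
  | cons x l ih =>
    obtain _ | ⟨x', l'⟩ := l'
    · simp at hlen
    simp only [List.mem_cons, forall_eq_or_imp] at hl hl'
    obtain ⟨h1, h⟩ := replicate_append_inj (by simp [head?_replicate_append hl.1.2])
      (by simp [head?_replicate_append hl'.1.2]) h
    obtain ⟨h2, h⟩ := replicate_append_inj (by simp [head?_blockWord hl.2 hp])
      (by simp [head?_blockWord hl'.2 hp']) h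
    obtain ⟨rfl, h3⟩ := ih (by simpa using hlen) hl.2 hl'.2 h
    exact ⟨by rw [Prod.ext h1 h2], h3⟩

/-- The representation of a word by nonempty blocks is the one with the fewest blocks. -/
theorem blockWord_minimal {l l' : List (ℕ × ℕ)} {p c t p' c' t' : ℕ}
    (hl' : ∀ x ∈ l', 0 < x.1 ∧ 0 < x.2) (hp' : 0 < p') (hc' : 0 < c')
    (h : blockWord l p c t = blockWord l' p' c' t') :
    l'.length ≤ l.length ∧ (l.length = l'.length → l = l' ∧ p = p' ∧ c = c' ∧ t = t') := by
  -- The number of descents is exactly the number of separators of the nonempty representation, and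
  -- at most that of any other one.
  have hd : descents false (blockWord l p c t) = l'.length + 1 := by
    rw [h, descents_blockWord_of_pos hl' hp' hc']
  have hle := descents_blockWord_le false l p c t
  refine ⟨by omega, fun hlen => ?_⟩
  obtain ⟨hl, hp, hc⟩ := pos_of_descents_blockWord (l := l) (p := p) (c := c) (t := t) (by omega)
  exact blockWord_inj hlen hl hp hc hl' hp' hc' h

/-! ### The accepted words -/

/-- The block lengths that remain after the first sweep on a word of `nsl`. -/
def lengths (n : ℕ) : List (ℕ × ℕ) := (List.range n).map fun i => (2 * i + 2, i + 1)

/-- Going back one sweep prepends a block of length 2 with a single `#` and lengthens all others,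
which leads from `lengths n` to `lengths (n + 1)`. -/
theorem lengths_succ (n : ℕ) :
    lengths (n + 1) = (2, 1) :: (lengths n).map fun x => (x.1 + 2, x.2 + 1) := by
  simp [lengths, List.range_succ_eq_map, Function.comp_def, mul_add]

theorem pos_of_mem_cons_map (l : List (ℕ × ℕ)) :
    ∀ x ∈ (2, 1) :: l.map fun x => (x.1 + 2, x.2 + 1), 0 < x.1 ∧ 0 < x.2 := by
  intro x hx
  rcases List.mem_cons.1 hx with rfl | hx
  · simp
  · obtain ⟨y, -, rfl⟩ := List.mem_map.1 hx
    simp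

/-- A pushdown of height `n + 1` demands `n + 1` further sweeps, and each sweep costs at least one
block. If there are just enough blocks, no two of them may ever merge, and then going back from the
final word `a a` determines all lengths. -/
theorem acc_start_blockWord {l : List (ℕ × ℕ)} {p c t : ℕ}
    (h : Acc [] .start (blockWord l p c t) (n + 1)) : n ≤ l.length ∧
      (n = l.length → l = lengths n ∧ p = 2 * n + 2 ∧ c = n + 1 ∧ t = 2 * n + 4) := by
  induction n generalizing l p c t with
  | zero =>
    refine ⟨Nat.zero_le _, fun hl => ?_⟩
    rcases acc_start_succ_iff.1 h with ⟨t', h1, h2⟩ | ⟨l', p', c', t', h1, -⟩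
    · obtain ⟨-, h3⟩ := blockWord_minimal (by simp) (by simp) (by simp) h1
      obtain ⟨rfl, rfl, rfl, rfl⟩ := h3 hl.symm
      have := congrArg List.length (acc_start_zero_iff.1 h2)
      exact ⟨rfl, rfl, rfl, by simpa using this⟩
    · obtain ⟨h3, -⟩ := blockWord_minimal (pos_of_mem_cons_map l') (by simp) (by simp) h1
      simp at h3
      omega
  | succ n ih =>
    rcases acc_start_succ_iff.1 h with ⟨t', -, h2⟩ | ⟨l', p', c', t', h1, h2⟩
    -- Here only letters `a` are left although more sweeps are due. Read as a block word with `c =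
    -- 0`, this contradicts `c = n + 1`.
    · obtain ⟨h3, h4⟩ := ih (l := []) (p := t') (c := 0) (t := 0) (by simpa [blockWord] using h2)
      have := (h4 (by simpa using h3)).2.2.1
      omega
    · obtain ⟨h3, h4⟩ := blockWord_minimal (pos_of_mem_cons_map l') (by simp) (by simp) h1
      obtain ⟨h5, h6⟩ := ih h2
      simp only [List.length_cons, List.length_map] at h3 h4
      refine ⟨by omega, fun hl => ?_⟩
      obtain ⟨rfl, rfl, rfl, rfl⟩ := h4 (by omega)
      obtain ⟨rfl, rfl, rfl, rfl⟩ := h6 (by simp at hl; omega)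
      exact ⟨(lengths_succ n).symm, by omega, by omega, by omega⟩

theorem acc_start_lengths (n : ℕ) :
    Acc [] .start (blockWord (lengths n) (2 * n + 2) (n + 1) (2 * n + 4)) (n + 1) := by
  induction n with
  | zero => exact acc_start_succ_iff.2 (.inl ⟨2, rfl, acc_start_zero_iff.2 rfl⟩)
  | succ n ih =>
    rw [lengths_succ]
    exact acc_start_succ_iff.2 (.inr ⟨_, _, _, _, rfl, ih⟩)

theorem dollarWord_eq (l : List (ℕ × ℕ)) (p c t : ℕ) : dollarWord l p c t =
    (l.flatMap fun x => replicate x.1 .a ++ .dollar :: replicate x.2 .hash) ++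
      dollarWord [] p c t := by
  induction l with
  | nil => rfl
  | cons x l ih => simp_all [dollarWord]

theorem nslWord_succ (k : ℕ) : nslWord (k + 1) =
    dollarWord ((List.range k).map fun i => (2 * i + 1, i + 1)) (2 * k + 1) (k + 1) (2 * k + 3) := by
  rw [dollarWord_eq]
  simp [nslWord, nslPrefix, dollarWord, List.flatMap_map]

theorem nslWord_add_two (n : ℕ) : nslWord (n + 2) =
    dollarWord ((1, 1) :: (lengths n).map fun x => (x.1 + 1, x.2 + 1)) (2 * n + 3) (n + 2)
      (2 * n + 5) := by
  rw [nslWord_succ]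
  simp [lengths, List.range_succ_eq_map, Function.comp_def, mul_add]

/-- After the first sweep the pushdown has height `l.length + 1`, which is the extreme case of
`acc_start_blockWord`. The words for `k = 0` and `k = 1` are the two that need no further sweep from
`start` to `final`. -/
theorem acc_init_iff_mem_nsl : Acc [] .init w 0 ↔ w ∈ nsl := by
  rw [acc_init_iff]
  constructor
  · rintro (rfl | rfl | ⟨l, p, c, t, rfl, h⟩)
    · exact ⟨0, rfl⟩
    · exact ⟨1, rfl⟩
    · obtain ⟨h1, rfl, rfl, rfl⟩ := (acc_start_blockWord h).2 rfl
      exact ⟨l.length + 2, by rw [nslWord_add_two, ← h1]⟩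
  · rintro ⟨_ | _ | n, rfl⟩
    · exact .inl rfl
    · exact .inr (.inl rfl)
    · refine .inr (.inr ⟨lengths n, _, _, _, nslWord_add_two n, ?_⟩)
      rw [show (lengths n).length = n by simp [lengths]]
      exact acc_start_lengths n

end Nsl

theorem nslAutomaton_nrLanguage : nslAutomaton.nrLanguage = nsl :=
  Set.ext fun _ => Nsl.acc_init_iff_mem_nsl

theorem nsl_mem_nrDIDPDAwtl : nsl ∈ nrDIDPDAwtl Letter :=
  ⟨nslAutomaton, nslAutomaton_deterministic, nslAutomaton_nrLanguage⟩

theorem nsl_mem_nrNIDPDAwtl : nsl ∈ nrNIDPDAwtl Letter :=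
  ⟨nslAutomaton, nslAutomaton_nrLanguage⟩

theorem nsl_notMem_NIDPDAwtl : nsl ∉ NIDPDAwtl Letter :=
  fun h => not_semilinear_nsl (semilinear_of_mem_NIDPDAwtl Letter nsl h)

theorem nsl_notMem_DIDPDAwtl : nsl ∉ DIDPDAwtl Letter :=
  fun ⟨M, _, h⟩ => nsl_notMem_NIDPDAwtl ⟨M, h⟩

end Translucent

theorem corollary4 :
    Translucent.ProperlyIncluded Translucent.DIDPDAwtl Translucent.nrDIDPDAwtl ∧
    Translucent.ProperlyIncluded Translucent.NIDPDAwtl Translucent.nrNIDPDAwtl ∧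
    -- every language of the returning families has a letter-equivalent context-free sublanguage
    (∀ (α : Type) [Finite α], ∀ L ∈ Translucent.NIDPDAwtl α,
      ∃ L' : Language α, L'.IsContextFree ∧ L' ≤ L ∧ Translucent.LetterEquivalent L' L) ∧
    -- and is therefore semilinear
    (∀ (α : Type) [Finite α], ∀ L ∈ Translucent.NIDPDAwtl α, Translucent.Semilinear L) ∧
    -- the separating language
    ¬ Translucent.Semilinear Translucent.nsl ∧
    Translucent.nsl ∈ Translucent.nrDIDPDAwtl Translucent.Letter ∧
    Translucent.nsl ∈ Translucent.nrNIDPDAwtl Translucent.Letter ∧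
    Translucent.nsl ∉ Translucent.DIDPDAwtl Translucent.Letter ∧
    Translucent.nsl ∉ Translucent.NIDPDAwtl Translucent.Letter := by
  open Translucent in
  exact ⟨⟨DIDPDAwtl_subset_nrDIDPDAwtl, Letter, inferInstance, nsl, nsl_mem_nrDIDPDAwtl,
      nsl_notMem_DIDPDAwtl⟩,
    ⟨NIDPDAwtl_subset_nrNIDPDAwtl, Letter, inferInstance, nsl, nsl_mem_nrNIDPDAwtl,
      nsl_notMem_NIDPDAwtl⟩,
    exists_contextFree_letterEquivalent, semilinear_of_mem_NIDPDAwtl, not_semilinear_nsl,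
    nsl_mem_nrDIDPDAwtl, nsl_mem_nrNIDPDAwtl, nsl_notMem_DIDPDAwtl, nsl_notMem_NIDPDAwtl⟩
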